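/- Let $(R,\mathfrak m)$ be a Cohen–Macaulay (Noetherian) local ring of dimension $d\ge 1$ with infinite residue field, let $I_1,I_2$ be $\mathfrak m$-primary ideals, and let $x_1,\dots,x_d\in I_2$ be a superficial sequence for $I_2$ and $I_1$ such that $(\mathbf x)=(x_1,\dots,x_d)$ is a minimal reduction of $I_2$. Put $I^n=R$ for $n\le 0$ and write $\ell$ for length. Here $x\in I_2$ is superficial for $I_2$ and $I_1$ if there is $r_0>0$ with $xR\cap I_1^sI_2^r=xI_1^sI_2^{r-1}$ for all $r\ge r_0$, $s\ge 0$; and $x_1,\dots,x_d$ is a superficial sequence if for each $a$ the image of $x_a$ in $R/(x_1,\dots,x_{a-1})$ is superficial for the images of $I_2$ and $I_1$. For $e\in\{0,1\}$ and $n\in\mathbb Z$ let $C(e,n)$ be the complex $$0\to R/I_1^eI_2^{n-d}\to\cdots\to (R/I_1^eI_2^{n-j})^{\binom dj}\to\cdots\to (R/I_1^eI_2^{n-1})^{\binom d1}\to R/I_1^eI_2^{n}\to 0$$ with maps induced by the Koszul complex of $\mathbf x$ over $R$, and let $h_j(C)(e,n)=\ell(H_j(C(e,n)))$. The Hilbert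 coefficients $f_0,\dots,f_{d-1}$, $f_i=f_{i,I_1}(I_2)$, of the fiber cone $\bigoplus_{n\ge0} I_2^n/I_1I_2^n$ are the unique integers with $$\ell(I_2^n/I_1I_2^n)=\sum_{i=0}^{d-1}(-1)^i f_i\binom{n+d-1-i}{d-1-i}\qquad\text{for all } n\gg 0 .$$ Then the lengths in what follows are finite, these coefficients exist, and for every $0\le i\le d-1$ both $$f_{i}=\sum_{n\ge i}\binom ni\Bigl[\ell\Bigl(\frac{I_2^n}{I_1I_2^n+(\mathbf x)\cap I_2^n}\Bigr)-\sum_{j\ge1}(-1)^j\bigl[h_j(C)(0,n)-h_j(C)(1,n)\bigr]\Bigr]-(-1)^d\ell\Bigl(\frac R{K_i}\Bigr)$$ and $$f_{i}=\sum_{n\ge i}\binom ni\Bigl[\ell\Bigl(\frac{I_2^n}{I_1I_2^n}\Bigr)-\ell\Bigl(\frac{(\mathbf x)I_2^{n-1}}{(\mathbf x)I_1I_2^{n-1}}\Bigr)-\sum_{j\ge2}(-1)^j\bigl[h_j(C)(0,n)-h_j(C)(1,n)\bigr]\Bigr]-(-1)^d\ell\Bigl(\frac R{K_i}\Bigr)$$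 hold, where $K_i=R$ for $0\le i\le d-2$ and $K_{d-1}=I_1$. In both sums only finitely many of the outer bracketed terms are nonzero. -/

import Mathlib

/-! Hilbert coefficients of fiber cones: ideals, Koszul-type complexes, lengths. -/

universe u

section Length

variable {R : Type u} [CommRing R]

/-- The length `ℓ(M)` as a natural number (meaningful when `M` has finite length). -/
noncomputable def len (R : Type u) [CommRing R] (M : Type u) [AddCommGroup M] [Module R M] : ℕ :=
  (Module.length R M).toNat

/-- The subquotient `N / L` of `R`, for ideals `L ⊆ N`. -/
abbrev IdealQuot (N L : Ideal R) : Type u := N ⧸ Submodule.submoduleOf L N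

end Length

section Ideals

variable {R : Type u} [CommRing R]

/-- A Cohen-Macaulay local ring: Noetherian local, with a regular sequence in the maximal ideal
whose length is the Krull dimension (that is, depth equals dimension). -/
def IsCohenMacaulayLocal (R : Type u) [CommRing R] [IsLocalRing R] : Prop :=
  IsNoetherianRing R ∧
    ∃ rs : List R, (∀ r ∈ rs, r ∈ IsLocalRing.maximalIdeal R) ∧
      RingTheory.Sequence.IsRegular R rs ∧ ((rs.length : ℕ) : WithBot ℕ∞) = ringKrullDim R

/-- `I` is primary to the maximal ideal of the local ring `R`. -/
def IsMaxPrimary [IsLocalRing R] (I : Ideal R) : Prop :=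
  I.IsPrimary ∧ I.radical = IsLocalRing.maximalIdeal R

/-- `J` is a reduction of `I`. -/
def IsReduction (I J : Ideal R) : Prop :=
  J ≤ I ∧ ∃ n : ℕ, J * I ^ n = I ^ (n + 1)

/-- `J` is a minimal reduction of `I`: minimal under inclusion among the reductions of `I`. -/
def IsMinimalReduction (I J : Ideal R) : Prop :=
  Minimal (IsReduction I) J

/-- `x` is superficial for `I₂` and `I₁`. -/
def IsSuperficial (I₁ I₂ : Ideal R) (x : R) : Prop :=
  x ∈ I₂ ∧ ∃ r₀ : ℕ, 0 < r₀ ∧ ∀ r : ℕ, r₀ ≤ r → ∀ s : ℕ,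
    Ideal.span {x} ⊓ I₁ ^ s * I₂ ^ r = Ideal.span {x} * (I₁ ^ s * I₂ ^ (r - 1))

/-- `x 0, …, x (k-1)` is a superficial sequence for `I₂` and `I₁`: for each `a`, the image of `x a`
modulo the earlier elements is superficial for the images of `I₂` and `I₁`. -/
def IsSuperficialSeq (I₁ I₂ : Ideal R) {k : ℕ} (x : Fin k → R) : Prop :=
  ∀ a : Fin k,
    let J : Ideal R := Ideal.span {r : R | ∃ b : Fin k, b < a ∧ r = x b}
    IsSuperficial (I₁.map (Ideal.Quotient.mk J)) (I₂.map (Ideal.Quotient.mk J))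
      (Ideal.Quotient.mk J (x a))

/-- `I ^ n` for an integer `n`, with `I ^ n = R` for `n ≤ 0`. -/
def ipow (I : Ideal R) (n : ℤ) : Ideal R := I ^ n.toNat

/-- The `I₂`-filtration `n ↦ I₁ ^ e * I₂ ^ n`. For `e = 0` it is `I₂ ^ n`, for `e = 1` it is
`I₁ * I₂ ^ n`. -/
def filt (I₁ I₂ : Ideal R) (e : ℕ) (n : ℤ) : Ideal R := I₁ ^ e * ipow I₂ n

theorem mul_mem_filt {I₁ I₂ : Ideal R} {e : ℕ} {y r : R} (hy : y ∈ I₂) {m n : ℤ}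
    (hmn : n ≤ m + 1) (hr : r ∈ filt I₁ I₂ e m) : y * r ∈ filt I₁ I₂ e n := by
  have h1 : y * r ∈ I₂ * filt I₁ I₂ e m := Ideal.mul_mem_mul hy hr
  have h2 : I₂ * filt I₁ I₂ e m ≤ filt I₁ I₂ e n := by
    have h3 : I₂ * (I₁ ^ e * I₂ ^ m.toNat) = I₁ ^ e * I₂ ^ (m.toNat + 1) := by ring
    simp only [filt, ipow]
    rw [h3]
    exact Ideal.mul_mono_right (Ideal.pow_le_pow_right (by omega))
  exact h2 h1

theorem filt_le_comap {I₁ I₂ : Ideal R} {y : R} (hy : y ∈ I₂) (e : ℕ) (n : ℤ) (j : ℕ) :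
    filt I₁ I₂ e (n - (j + 1 : ℕ)) ≤
      Submodule.comap (LinearMap.lsmul R R y) (filt I₁ I₂ e (n - j)) :=
  fun _ hr => mul_mem_filt hy (by push_cast; omega) hr

end Ideals

namespace FiberComplex

variable {R : Type u} [CommRing R] (I₁ I₂ : Ideal R) {k : ℕ} (x : Fin k → R)

/-- The `j`-element subsets of `{0, …, k-1}`, indexing the standard basis of the `j`-th term of the
Koszul complex. -/
abbrev Idx (k j : ℕ) : Type := {s : Finset (Fin k) // s.card = j}

/-- The term `(R / I₁ ^ e I₂ ^ (n - j)) ^ (k choose j)` of the complex `C(x, (e, n))`. -/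
abbrev Term (k e : ℕ) (n : ℤ) (j : ℕ) : Type u :=
  Idx k j → R ⧸ filt I₁ I₂ e (n - j)

/-- Multiplication by `y ∈ I₂`, as a map `R / I₁ ^ e I₂ ^ (n - (j + 1)) → R / I₁ ^ e I₂ ^ (n - j)`. -/
def mulMap {y : R} (hy : y ∈ I₂) (e : ℕ) (n : ℤ) (j : ℕ) :
    (R ⧸ filt I₁ I₂ e (n - (j + 1 : ℕ))) →ₗ[R] (R ⧸ filt I₁ I₂ e (n - j)) :=
  Submodule.mapQ _ _ (LinearMap.lsmul R R y) (filt_le_comap hy e n j)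

/-- The subset `s ∪ {a}`, for `a ∉ s`. -/
def ins {j : ℕ} (s : Idx k j) (a : {a : Fin k // a ∉ s.1}) : Idx k (j + 1) :=
  ⟨insert a.1 s.1, by rw [Finset.card_insert_of_notMem a.2, s.2]⟩

/-- The Koszul sign of `a` in `s ∪ {a}`: `(-1)` to the number of elements of `s` below `a`. -/
def sgn (s : Finset (Fin k)) (a : Fin k) : ℤ := (-1) ^ (s.filter (fun b => b < a)).card

variable {x}

/-- The differential, induced by that of the Koszul complex of `x` over `R`,
`e_{a_1} ∧ ⋯ ∧ e_{a_j} ↦ ∑ (-1)^(r-1) x_{a_r} e_{a_1} ∧ ⋯ (omit e_{a_r}) ⋯ ∧ e_{a_j}`,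
written in coordinates. -/
def diff (hx : ∀ a, x a ∈ I₂) (e : ℕ) (n : ℤ) (j : ℕ) :
    Term I₁ I₂ k e n (j + 1) →ₗ[R] Term I₁ I₂ k e n j :=
  LinearMap.pi fun s =>
    ∑ a : {a : Fin k // a ∉ s.1},
      sgn s.1 a.1 • (mulMap I₁ I₂ (hx a.1) e n j ∘ₗ LinearMap.proj (ins s a))

theorem sgn_mul_sgn (s : Finset (Fin k)) {a b : Fin k} (ha : a ∉ s) (hb : b ∉ s) (hab : a ≠ b) :
    sgn s a * sgn (insert a s) b = -(sgn s b * sgn (insert b s) a) := by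
  unfold sgn
  rw [Finset.filter_insert, Finset.filter_insert]
  rcases lt_or_gt_of_ne hab with h | h
  · rw [if_pos h, if_neg (not_lt.mpr h.le),
      Finset.card_insert_of_notMem (by simp [ha])]
    ring
  · rw [if_neg (not_lt.mpr h.le), if_pos h,
      Finset.card_insert_of_notMem (by simp [hb])]
    ring

theorem mulMap_comm {y z : R} (hy : y ∈ I₂) (hz : z ∈ I₂) (e : ℕ) (n : ℤ) (j : ℕ)
    (w : R ⧸ filt I₁ I₂ e (n - (j + 1 + 1 : ℕ))) :
    mulMap I₁ I₂ hy e n j (mulMap I₁ I₂ hz e n (j + 1) w) =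
      mulMap I₁ I₂ hz e n j (mulMap I₁ I₂ hy e n (j + 1) w) := by
  obtain ⟨w, rfl⟩ := Submodule.Quotient.mk_surjective _ w
  have h : y • z • w = z • y • w := smul_comm y z w
  exact congrArg (Submodule.Quotient.mk (p := filt I₁ I₂ e (n - j))) h

theorem diff_apply (hx : ∀ a, x a ∈ I₂) (e : ℕ) (n : ℤ) (j : ℕ)
    (f : Term I₁ I₂ k e n (j + 1)) (s : Idx k j) :
    diff I₁ I₂ hx e n j f s = ∑ a : {a : Fin k // a ∉ s.1},
      sgn s.1 a.1 • mulMap I₁ I₂ (hx a.1) e n j (f (ins s a)) := by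
  simp [diff]

theorem diff_comp_diff (hx : ∀ a, x a ∈ I₂) (e : ℕ) (n : ℤ) (j : ℕ) :
    diff I₁ I₂ hx e n j ∘ₗ diff I₁ I₂ hx e n (j + 1) = 0 := by
  refine LinearMap.ext fun f => funext fun s => ?_
  rw [LinearMap.comp_apply, diff_apply]
  simp only [diff_apply, map_sum, Finset.smul_sum, map_zsmul, smul_smul]
  rw [Finset.sum_sigma']
  have mem : ∀ p : (a : {a : Fin k // a ∉ s.1}) × {b : Fin k // b ∉ (ins s a).1},
      p.2.1 ≠ p.1.1 ∧ p.2.1 ∉ s.1 := fun p => by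
    have := p.2.2
    simpa [ins, not_or] using this
  have swap : ∀ p : (a : {a : Fin k // a ∉ s.1}) × {b : Fin k // b ∉ (ins s a).1},
      p.1.1 ∉ (ins s ⟨p.2.1, (mem p).2⟩).1 := fun p => by
    simp only [ins, Finset.mem_insert, not_or]
    exact ⟨(mem p).1.symm, p.1.2⟩
  refine Finset.sum_involution
    (fun p _ => ⟨⟨p.2.1, (mem p).2⟩, ⟨p.1.1, swap p⟩⟩) ?_ ?_ ?_ ?_
  · intro p _
    have hins : ins (ins s p.1) p.2 = ins (ins s ⟨p.2.1, (mem p).2⟩) ⟨p.1.1, swap p⟩ :=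
      Subtype.ext (Finset.insert_comm _ _ _)
    rw [← hins, mulMap_comm I₁ I₂ (hx p.2.1) (hx p.1.1)]
    have hs := sgn_mul_sgn s.1 p.1.2 (mem p).2 (mem p).1.symm
    have hs' : sgn s.1 p.1.1 * sgn (ins s p.1).1 p.2.1 =
        -(sgn s.1 p.2.1 * sgn (ins s ⟨p.2.1, (mem p).2⟩).1 p.1.1) := hs
    rw [hs', neg_smul]
    exact neg_add_cancel _
  · intro p _ _ heq
    exact (mem p).1 (congrArg (fun q => q.1.1) heq)
  · intro p _
    simp
  · intro p _
    rfl

/-- The `j`-cycles of `C(x, (e, n))`. -/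
def cycles (hx : ∀ a, x a ∈ I₂) (e : ℕ) (n : ℤ) : (j : ℕ) → Submodule R (Term I₁ I₂ k e n j)
  | 0 => ⊤
  | j + 1 => LinearMap.ker (diff I₁ I₂ hx e n j)

/-- The `j`-boundaries of `C(x, (e, n))`. -/
def boundaries (hx : ∀ a, x a ∈ I₂) (e : ℕ) (n : ℤ) (j : ℕ) : Submodule R (Term I₁ I₂ k e n j) :=
  LinearMap.range (diff I₁ I₂ hx e n j)

theorem boundaries_le_cycles (hx : ∀ a, x a ∈ I₂) (e : ℕ) (n : ℤ) (j : ℕ) :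
    boundaries I₁ I₂ hx e n j ≤ cycles I₁ I₂ hx e n j := by
  cases j with
  | zero => exact le_top
  | succ j =>
    rintro _ ⟨y, rfl⟩
    exact LinearMap.congr_fun (diff_comp_diff I₁ I₂ hx e n j) y

/-- The homology module `H_j(C(x, (e, n)))`. -/
abbrev Homology (hx : ∀ a, x a ∈ I₂) (e : ℕ) (n : ℤ) (j : ℕ) : Type u :=
  cycles I₁ I₂ hx e n j ⧸
    Submodule.submoduleOf (boundaries I₁ I₂ hx e n j) (cycles I₁ I₂ hx e n j)

/-- `h_j(C)(e, n) = ℓ(H_j(C(x, (e, n))))`. -/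
noncomputable def h (hx : ∀ a, x a ∈ I₂) (e : ℕ) (n : ℤ) (j : ℕ) : ℕ :=
  len R (Homology I₁ I₂ hx e n j)

end FiberComplex

section FiberCone

variable {R : Type u} [CommRing R]

/-- The Hilbert function `n ↦ ℓ(I₂ ^ n / I₁ I₂ ^ n)` of the fiber cone of `I₂` with respect
to `I₁`. -/
noncomputable def fiberHilb (I₁ I₂ : Ideal R) (n : ℕ) : ℕ :=
  len R (IdealQuot (I₂ ^ n) (I₁ * I₂ ^ n))

/-- `f 0, …, f (d-1)` are the Hilbert coefficients of the fiber cone: for all large `n`, the Hilbert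
function is `∑ (-1)^i f_i (n + d - 1 - i choose d - 1 - i)`. -/
def IsFiberCoeffs (I₁ I₂ : Ideal R) {d : ℕ} (f : Fin d → ℤ) : Prop :=
  ∀ᶠ n : ℕ in Filter.atTop,
    (fiberHilb I₁ I₂ n : ℤ) =
      ∑ i : Fin d, (-1) ^ (i : ℕ) * f i * ((n + (d - 1 - (i : ℕ))).choose (d - 1 - (i : ℕ)) : ℤ)

/-- `K_i = R` for `i = 0, …, d - 2` and `K_{d-1} = I₁`. -/
def Kideal (I₁ : Ideal R) (d i : ℕ) : Ideal R := if i + 1 = d then I₁ else ⊤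

/-- The summand
`ℓ(I₂ⁿ / (I₁I₂ⁿ + (x) ∩ I₂ⁿ)) - ∑_{j ≥ 1} (-1)^j [h_j(C)(0,n) - h_j(C)(1,n)]`.
The terms with `j > k` vanish, since the complex is zero there. -/
noncomputable def bracketOne (I₁ I₂ : Ideal R) {k : ℕ} {x : Fin k → R} (hx : ∀ a, x a ∈ I₂)
    (n : ℕ) : ℤ :=
  (len R (IdealQuot (I₂ ^ n) (I₁ * I₂ ^ n + Ideal.span (Set.range x) ⊓ I₂ ^ n)) : ℤ) -
    ∑ j ∈ Finset.Icc 1 k, (-1) ^ j *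
      ((FiberComplex.h I₁ I₂ hx 0 n j : ℤ) - (FiberComplex.h I₁ I₂ hx 1 n j : ℤ))

/-- The summand
`[ℓ(I₂ⁿ / I₁I₂ⁿ) - ℓ((x)I₂ⁿ⁻¹ / (x)I₁I₂ⁿ⁻¹)] - ∑_{j ≥ 2} (-1)^j [h_j(C)(0,n) - h_j(C)(1,n)]`. -/
noncomputable def bracketTwo (I₁ I₂ : Ideal R) {k : ℕ} {x : Fin k → R} (hx : ∀ a, x a ∈ I₂)
    (n : ℕ) : ℤ :=
  ((len R (IdealQuot (I₂ ^ n) (I₁ * I₂ ^ n)) : ℤ) -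
    (len R (IdealQuot (Ideal.span (Set.range x) * ipow I₂ ((n : ℤ) - 1))
      (Ideal.span (Set.range x) * (I₁ * ipow I₂ ((n : ℤ) - 1)))) : ℤ)) -
    ∑ j ∈ Finset.Icc 2 k, (-1) ^ j *
      ((FiberComplex.h I₁ I₂ hx 0 n j : ℤ) - (FiberComplex.h I₁ I₂ hx 1 n j : ℤ))

end FiberCone

/-! Write `F n` for the length of `I₂ ^ n / I₁ I₂ ^ n`. The Euler characteristic of `C(e, n)` can be
computed from its homology or from its terms (`sum_h`). Subtracting the case `e = 0` from `e = 1`,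
the terms give the `d`-th backward difference of `F`. Since nonpositive powers of `I₂` are `R`, here
`F` is continued to negative integers by the constant `F 0`, the colength of `I₁`. On the homology
side, the modular law turns the two `h_0` into the length in the first bracket, so that bracket is
exactly this difference (`FiniteColengths.bracketOne_eq`). The second bracket equals the first
because `H_1` is `((x) ∩ I₁ ^ e I₂ ^ n) / (x) I₁ ^ e I₂ ^ (n - 1)` (`h_one`).

Two facts about the Koszul complex of `x` enter. It is exact in positive degrees, by depth
sensitivity (`koszul_exact`). Multiplication by `(x)` is null-homotopic on it, which together with
Artin–Rees kills the positive homology of `C(e, n)` for large `n` (`h_eq_zero_of_large`); hence only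
finitely many brackets are nonzero.

It remains to sum. If `b` is the difference, then `(1 - X) ^ d ∑ F n X ^ n = ∑ b n X ^ n + F 0 (1 -
X) ^ (d - 1)` is a polynomial, and the Hilbert coefficients are its first `d` Taylor coefficients at
`1`. The sum over `b` contributes `∑ binom(n, i) b n`. The correction contributes only at `i = d -
1`, which explains the ideals `K_i`. -/

namespace FiberComplex

/-! ### The Koszul complex and its depth sensitivity. -/

section Koszul

variable {R : Type u} [CommRing R] {M : Type u} [AddCommGroup M] [Module R M] {k : ℕ}

/-- The differential of the Koszul complex of `x` with coefficients in `M`, on the direct sum of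
all its terms: a function `Finset (Fin k) → M` lists the coordinates of an element. -/
def koszul (M : Type u) [AddCommGroup M] [Module R M] (x : Fin k → R) :
    (Finset (Fin k) → M) →ₗ[R] (Finset (Fin k) → M) :=
  LinearMap.pi fun s => ∑ a : Fin k,
    if a ∈ s then 0 else sgn s a • x a • LinearMap.proj (insert a s)

theorem koszul_apply (x : Fin k → R) (f : Finset (Fin k) → M) (s : Finset (Fin k)) :
    koszul M x f s = ∑ a : Fin k, if a ∈ s then 0 else sgn s a • x a • f (insert a s) := by
  simp only [koszul, LinearMap.pi_apply, LinearMap.sum_apply]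
  refine Finset.sum_congr rfl fun a _ => ?_
  split_ifs <;> simp

theorem koszul_koszul (x : Fin k → R) (f : Finset (Fin k) → M) :
    koszul M x (koszul M x f) = 0 := by
  funext s
  rw [koszul_apply]
  have key : ∀ a : Fin k, (if a ∈ s then 0 else sgn s a • x a • koszul M x f (insert a s)) =
      ∑ b : Fin k, if a ∈ s ∨ b ∈ s ∨ a = b then 0 else
        (sgn s a * sgn (insert a s) b) • (x a * x b) • f (insert b (insert a s)) := by
    intro a
    by_cases ha : a ∈ s
    · simp [ha]
    · rw [if_neg ha, koszul_apply, Finset.smul_sum, Finset.smul_sum]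
      refine Finset.sum_congr rfl fun b _ => ?_
      by_cases hb : b ∈ s
      · simp [hb]
      by_cases hab : a = b
      · simp [hab]
      rw [if_neg (by simp [hb, Ne.symm hab]), if_neg (by simp [ha, hb, hab]), mul_smul, mul_smul,
        smul_comm (x a)]
  simp only [key, Pi.zero_apply]
  rw [← Finset.sum_product']
  -- Removing two basis vectors in either order gives opposite signs, so the pairs `(a, b)` and `(b,
  -- a)` cancel.
  refine Finset.sum_involution (fun p _ => (p.2, p.1)) ?_ ?_ (fun _ _ => Finset.mem_univ _)
    (fun _ _ => rfl)
  · rintro ⟨a, b⟩ _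
    by_cases h : a ∈ s ∨ b ∈ s ∨ a = b
    · rw [if_pos h, if_pos (by tauto), add_zero]
    · rw [if_neg h, if_neg (by tauto)]
      push Not at h
      rw [sgn_mul_sgn s h.1 h.2.1 h.2.2, neg_smul, mul_comm (x a), Finset.insert_comm]
      exact neg_add_cancel _
  · rintro ⟨a, b⟩ _ hne heq
    refine hne (if_pos (Or.inr (Or.inr ?_)))
    exact congrArg Prod.snd heq

/-- Exterior multiplication by the `b`-th basis vector. -/
def wedge (b : Fin k) (f : Finset (Fin k) → M) : Finset (Fin k) → M :=
  fun s => if b ∈ s then sgn (s.erase b) b • f (s.erase b) else 0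

theorem sgn_mul_self (s : Finset (Fin k)) (a : Fin k) : sgn s a * sgn s a = 1 := by
  unfold sgn
  rw [← mul_pow]
  simp

/-- The contracting homotopy: on cycles it makes `x b • f` the boundary of `wedge b f`. It is used
both for depth sensitivity and for the vanishing at large `n`. -/
theorem koszul_wedge_add (x : Fin k → R) (b : Fin k) (f : Finset (Fin k) → M) :
    koszul M x (wedge b f) + wedge b (koszul M x f) = x b • f := by
  funext s
  rw [Pi.add_apply, Pi.smul_apply, koszul_apply]
  by_cases hb : b ∈ s
  · obtain ⟨t, hbt, rfl⟩ : ∃ t, b ∉ t ∧ s = insert b t :=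
      ⟨s.erase b, Finset.notMem_erase b s, (Finset.insert_erase hb).symm⟩
    simp only [wedge, Finset.mem_insert_self, if_true, Finset.erase_insert hbt, koszul_apply]
    rw [Finset.smul_sum, ← Finset.sum_add_distrib, Finset.sum_eq_single b]
    · simp only [Finset.mem_insert_self, if_true, if_neg hbt, zero_add]
      rw [smul_smul, sgn_mul_self, one_smul]
    · intro a _ hab
      by_cases hat : a ∈ t
      · simp [hat]
      rw [if_neg (by simp [hab, hat]), if_neg hat, if_pos (by simp),
        Finset.insert_comm, Finset.erase_insert (by simp [hbt, Ne.symm hab])]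
      have h1 := sgn_mul_sgn t hat hbt hab
      have h2 := sgn_mul_self (insert a t) b
      have h3 := sgn_mul_self t b
      rw [smul_comm (x a), smul_smul, smul_smul, ← add_smul]
      -- Multiply the anticommutation relation `h1` by two signs and cancel the squares.
      have : sgn (insert b t) a * sgn (insert a t) b + sgn t b * sgn t a = 0 := by
        linear_combination (sgn t b * sgn (insert a t) b) * h1 -
          (sgn t b * sgn t a) * h2 - (sgn (insert b t) a * sgn (insert a t) b) * h3
      rw [this, zero_smul]
    · simp
  · rw [wedge, if_neg hb, add_zero, Finset.sum_eq_single b]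
    · rw [if_neg hb, wedge, if_pos (by simp), Finset.erase_insert hb, smul_comm (x b), smul_smul,
        sgn_mul_self, one_smul]
    · intro a _ hab
      split_ifs with ha
      · rfl
      · rw [wedge, if_neg (by simp [hb, Ne.symm hab]), smul_zero, smul_zero]
    · simp

theorem koszul_comp_linearMap {N : Type u} [AddCommGroup N] [Module R N] (φ : M →ₗ[R] N)
    (x : Fin k → R) (f : Finset (Fin k) → M) :
    koszul N x (φ ∘ f) = φ ∘ koszul M x f := by
  funext s
  simp only [koszul_apply, Function.comp_apply, map_sum]
  refine Finset.sum_congr rfl fun a _ => ?_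
  split_ifs <;> simp

/-- All coordinates of degree less than `j` vanish. -/
def VanishBelow (j : ℕ) (f : Finset (Fin k) → M) : Prop := ∀ s, s.card < j → f s = 0

theorem VanishBelow.wedge {j : ℕ} {f : Finset (Fin k) → M} (hf : VanishBelow j f) (b : Fin k) :
    VanishBelow (j + 1) (wedge b f) := by
  intro s hs
  unfold FiberComplex.wedge
  split_ifs with hb
  · rw [hf _ (by rw [Finset.card_erase_of_mem hb]; have := Finset.card_pos.mpr ⟨b, hb⟩; omega),
      smul_zero]
  · rfl

theorem VanishBelow.koszul {j : ℕ} {x : Fin k → R} {f : Finset (Fin k) → M}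
    (hf : VanishBelow (j + 1) f) : VanishBelow j (koszul M x f) := by
  intro s hs
  rw [koszul_apply]
  refine Finset.sum_eq_zero fun a _ => ?_
  split_ifs with ha
  · rfl
  · rw [hf _ (by rw [Finset.card_insert_of_notMem ha]; omega), smul_zero, smul_zero]

theorem exists_koszul_eq_smul_of_mem_span {x : Fin k → R} {j : ℕ} {f : Finset (Fin k) → M}
    (hf : VanishBelow j f) (hD : koszul M x f = 0) {z : R} (hz : z ∈ Ideal.span (Set.range x)) :
    ∃ g, VanishBelow (j + 1) g ∧ koszul M x g = z • f := by
  induction hz using Submodule.span_induction with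
  | mem z hz =>
    obtain ⟨b, rfl⟩ := hz
    refine ⟨wedge b f, hf.wedge b, ?_⟩
    rw [← koszul_wedge_add, hD]
    have : wedge b (0 : Finset (Fin k) → M) = 0 := by
      funext s
      simp [wedge]
    rw [this, add_zero]
  | zero => exact ⟨0, fun _ _ => rfl, by simp⟩
  | add z w _ _ hz hw =>
    obtain ⟨g, hg, hg'⟩ := hz
    obtain ⟨g₁, hg₁, hg₁'⟩ := hw
    exact ⟨g + g₁, fun s hs => by rw [Pi.add_apply, hg s hs, hg₁ s hs, add_zero],
      by rw [map_add, hg', hg₁', add_smul]⟩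
  | smul c z _ hz =>
    obtain ⟨g, hg, hg'⟩ := hz
    exact ⟨c • g, fun s hs => by rw [Pi.smul_apply, hg s hs, smul_zero],
      by rw [map_smul, hg', smul_assoc]⟩

/-- Depth sensitivity of the Koszul complex: if `ys` is a weakly regular sequence on `M` in the
radical of `(x)`, the Koszul homology of `x` on `M` vanishes in degrees `> k - length ys`. -/
theorem koszul_exact (x : Fin k → R) (ys : List R) :
    ∀ (M : Type u) [AddCommGroup M] [Module R M], RingTheory.Sequence.IsWeaklyRegular M ys →
      (∀ y ∈ ys, ∃ N : ℕ, y ^ N ∈ Ideal.span (Set.range x)) →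
      ∀ j, k < j + ys.length → ∀ f : Finset (Fin k) → M, VanishBelow j f → koszul M x f = 0 →
        ∃ g, VanishBelow (j + 1) g ∧ koszul M x g = f := by
  induction ys with
  | nil =>
    intro M _ _ _ _ j hj f hf _
    refine ⟨0, fun _ _ => rfl, ?_⟩
    funext s
    -- Here `k < j`, and no subset has `j` elements, so `f` is zero.
    rw [hf s ((Finset.card_le_univ s).trans_lt (by simpa using hj)), map_zero, Pi.zero_apply]
  | cons y ys ih =>
    intro M _ _ hreg hpow j hj f hf hD
    rw [RingTheory.Sequence.isWeaklyRegular_cons_iff] at hreg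
    obtain ⟨hy, hreg⟩ := hreg
    -- If `y • f` is the boundary of `g`, then `g` is a cycle modulo `y`, one degree higher. By
    -- induction it is a boundary there, so after subtracting a lifted boundary `g` is divisible by
    -- `y`; the quotient has boundary `f` because `y` is a nonzerodivisor.
    have descend : ∀ f : Finset (Fin k) → M, VanishBelow j f → koszul M x f = 0 →
        (∃ g, VanishBelow (j + 1) g ∧ koszul M x g = y • f) →
        ∃ g, VanishBelow (j + 1) g ∧ koszul M x g = f := by
      rintro f hf hD ⟨g, hg, hgf⟩
      let π : M →ₗ[R] QuotSMulTop y M := Submodule.mkQ _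
      have hπ : Function.Surjective π := Submodule.mkQ_surjective _
      have hπy : ∀ m : M, π (y • m) = 0 := fun m =>
        (Submodule.Quotient.mk_eq_zero _).mpr
          (Submodule.smul_mem_pointwise_smul m y ⊤ Submodule.mem_top)
      obtain ⟨c, hc, hcg⟩ := ih (QuotSMulTop y M) hreg
        (fun z hz => hpow z (List.mem_cons_of_mem _ hz)) (j + 1)
        (by simp only [List.length_cons] at hj; omega) (π ∘ g)
        (fun s hs => by rw [Function.comp_apply, hg s hs, map_zero])
        (by
          rw [koszul_comp_linearMap, hgf]
          funext s
          exact hπy _)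
      -- The lift is chosen zero in low degrees, so that its boundary does not spoil the vanishing
      -- of `g`.
      have hlift : ∀ s, ∃ m : M, π m = c s ∧ (s.card < j + 1 + 1 → m = 0) := by
        intro s
        by_cases hs : s.card < j + 1 + 1
        · exact ⟨0, by rw [hc s hs, map_zero], fun _ => rfl⟩
        · obtain ⟨m, hm⟩ := hπ (c s)
          exact ⟨m, hm, fun h => absurd h hs⟩
      choose c' hc' hc'0 using hlift
      have hc'c : c = π ∘ c' := funext fun s => (hc' s).symm
      have hu : ∀ s, ∃ m : M, y • m = (g - koszul M x c') s := by
        intro s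
        have : π ((g - koszul M x c') s) = 0 := by
          rw [Pi.sub_apply, map_sub, sub_eq_zero]
          rw [hc'c, koszul_comp_linearMap] at hcg
          exact (congrFun hcg s).symm
        have := (Submodule.Quotient.mk_eq_zero _).mp this
        obtain ⟨m, _, hm⟩ := Submodule.mem_smul_pointwise_iff_exists _ _ _ |>.mp this
        exact ⟨m, hm⟩
      choose w hw using hu
      have hw' : y • w = g - koszul M x c' := funext hw
      refine ⟨w, fun s hs => hy ?_, funext fun s => hy ?_⟩
      · change y • w s = y • 0
        rw [hw, Pi.sub_apply, hg s hs, VanishBelow.koszul (j := j + 1) hc'0 s hs, sub_zero,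
          smul_zero]
      · change (y • koszul M x w) s = (y • f) s
        rw [← map_smul, hw', map_sub, koszul_koszul, sub_zero, hgf]
    -- Since `y ^ N` lies in `(x)`, the homotopy makes `y ^ N • f` a boundary; `descend` then
    -- removes one factor `y` at a time.
    obtain ⟨N, hN⟩ := hpow y List.mem_cons_self
    have descend_pow : ∀ N : ℕ, (∃ g, VanishBelow (j + 1) g ∧ koszul M x g = y ^ N • f) →
        ∃ g, VanishBelow (j + 1) g ∧ koszul M x g = f := by
      intro N
      induction N with
      | zero => simp
      | succ N ihN =>
        intro h
        refine ihN (descend (y ^ N • f) (fun s hs => by rw [Pi.smul_apply, hf s hs, smul_zero])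
          (by rw [map_smul, hD, smul_zero]) ?_)
        rwa [smul_smul, ← pow_succ']
    exact descend_pow N (exists_koszul_eq_smul_of_mem_span hf hD hN)

end Koszul

end FiberComplex

/-! ### Lengths and colengths of ideals. -/

section Lengths

variable {R : Type u} [CommRing R]

theorem len_eq_of_equiv {M N : Type u} [AddCommGroup M] [Module R M] [AddCommGroup N] [Module R N]
    (e : M ≃ₗ[R] N) : len R M = len R N := by
  rw [len, len, e.length_eq]

/-- Homology modules are compared with ideal subquotients by presenting both as quotients of one
module of Koszul chains over `R`. -/
theorem len_eq_of_ker_eq {P M N : Type u} [AddCommGroup P] [Module R P] [AddCommGroup M]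
    [Module R M] [AddCommGroup N] [Module R N] (α : P →ₗ[R] M) (β : P →ₗ[R] N)
    (hα : Function.Surjective α) (hβ : Function.Surjective β)
    (h : ∀ p, α p = 0 ↔ β p = 0) : len R M = len R N := by
  have hk : LinearMap.ker α = LinearMap.ker β := by
    ext p
    exact h p
  exact len_eq_of_equiv ((α.quotKerEquivOfSurjective hα).symm ≪≫ₗ
    Submodule.quotEquivOfEq _ _ hk ≪≫ₗ β.quotKerEquivOfSurjective hβ)

theorem len_quotient_add_len {M : Type u} [AddCommGroup M] [Module R M]
    (hM : Module.length R M ≠ ⊤) (N : Submodule R M) : len R M = len R N + len R (M ⧸ N) := by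
  have h := Module.length_eq_add_of_exact N.subtype N.mkQ N.injective_subtype
    (Submodule.mkQ_surjective N) (LinearMap.exact_subtype_mkQ N)
  rw [h] at hM
  rw [len, h, ENat.toNat_add (fun h' => hM (by simp [h'])) (fun h' => hM (by simp [h']))]
  rfl

theorem length_submodule_ne_top {M : Type u} [AddCommGroup M] [Module R M]
    (hM : Module.length R M ≠ ⊤) (N : Submodule R M) : Module.length R N ≠ ⊤ :=
  ne_top_of_le_ne_top hM (Module.length_le_of_injective N.subtype N.injective_subtype)

theorem length_quotient_ne_top {M : Type u} [AddCommGroup M] [Module R M]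
    (hM : Module.length R M ≠ ⊤) (N : Submodule R M) : Module.length R (M ⧸ N) ≠ ⊤ :=
  ne_top_of_le_ne_top hM (Module.length_le_of_surjective N.mkQ (Submodule.mkQ_surjective N))

/-- The colength of an ideal, as an integer. -/
noncomputable def colen (J : Ideal R) : ℤ := len R (R ⧸ J)

/-- The inclusion of the subquotient `N / L` in `R / L`. -/
noncomputable def idealQuotIncl (N L : Ideal R) : IdealQuot N L →ₗ[R] R ⧸ L :=
  Submodule.mapQ _ _ N.subtype (fun _ h => h)

theorem idealQuotIncl_injective (N L : Ideal R) : Function.Injective (idealQuotIncl N L) := by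
  rw [← LinearMap.ker_eq_bot, LinearMap.ker_eq_bot']
  intro q hq
  obtain ⟨q, rfl⟩ := Submodule.Quotient.mk_surjective _ q
  rw [Submodule.Quotient.mk_eq_zero]
  exact (Submodule.Quotient.mk_eq_zero L).mp hq

theorem length_idealQuot_ne_top {L : Ideal R} (hL : Module.length R (R ⧸ L) ≠ ⊤) (N : Ideal R) :
    Module.length R (IdealQuot N L) ≠ ⊤ :=
  ne_top_of_le_ne_top hL
    (Module.length_le_of_injective (idealQuotIncl N L) (idealQuotIncl_injective N L))

theorem len_idealQuot {N L : Ideal R} (hLN : L ≤ N) (hL : Module.length R (R ⧸ L) ≠ ⊤) :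
    (len R (IdealQuot N L) : ℤ) = colen L - colen N := by
  have h := Module.length_eq_add_of_exact (idealQuotIncl N L) (Submodule.factor hLN)
    (idealQuotIncl_injective N L) (Submodule.factor_surjective hLN) (by
      intro q
      obtain ⟨q, rfl⟩ := Submodule.Quotient.mk_surjective _ q
      constructor
      · intro hq
        have hq' : q ∈ N := (Submodule.Quotient.mk_eq_zero N).mp hq
        exact ⟨Submodule.Quotient.mk ⟨q, hq'⟩, rfl⟩
      · rintro ⟨p, hp⟩
        obtain ⟨p, rfl⟩ := Submodule.Quotient.mk_surjective _ p
        rw [← hp]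
        exact (Submodule.Quotient.mk_eq_zero N).mpr p.2)
  have h1 := hL
  rw [h] at h1
  have : len R (R ⧸ L) = len R (IdealQuot N L) + len R (R ⧸ N) := by
    rw [len, h, ENat.toNat_add (fun h' => h1 (by simp [h'])) (fun h' => h1 (by simp [h']))]
    rfl
  rw [colen, colen, this]
  push_cast
  ring

/-- The second isomorphism theorem `B / (A ⊓ B) ≃ (A ⊔ B) / A`, read in colengths. -/
theorem colen_sup_add_colen_inf {A B : Ideal R} (h : Module.length R (R ⧸ A ⊓ B) ≠ ⊤) :
    colen (A ⊔ B) + colen (A ⊓ B) = colen A + colen B := by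
  have hA : Module.length R (R ⧸ A) ≠ ⊤ := ne_top_of_le_ne_top h
    (Module.length_le_of_surjective (Submodule.factor inf_le_left)
      (Submodule.factor_surjective inf_le_left))
  have h1 := len_idealQuot (inf_le_right : A ⊓ B ≤ B) h
  have h2 := len_idealQuot (le_sup_left : A ≤ A ⊔ B) hA
  have h3 : len R (IdealQuot B (A ⊓ B)) = len R (IdealQuot (A ⊔ B) A) := by
    rw [sup_comm]
    refine len_eq_of_equiv (Submodule.quotEquivOfEq _ _ ?_ ≪≫ₗ
      LinearMap.quotientInfEquivSupQuotient B A)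
    ext b
    simp [Submodule.submoduleOf]
  rw [h3] at h1
  linarith

/-- Every prime over `J` is the maximal ideal, so `R ⧸ J` is Noetherian of dimension at most zero,
hence Artinian. -/
theorem length_quotient_ne_top_of_le_radical [IsLocalRing R] [IsNoetherianRing R] {J : Ideal R}
    (hJ : IsLocalRing.maximalIdeal R ≤ J.radical) : Module.length R (R ⧸ J) ≠ ⊤ := by
  have hart : IsArtinianRing (R ⧸ J) := by
    rw [isArtinianRing_iff_isNoetherianRing_krullDimLE_zero]
    refine ⟨inferInstance, Ring.KrullDimLE.mk₀ fun p hp => ?_⟩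
    have hle : IsLocalRing.maximalIdeal R ≤ p.comap (Ideal.Quotient.mk J) := by
      refine hJ.trans ((Ideal.IsPrime.radical_le_iff (hp.comap _)).mpr ?_)
      intro a ha
      rw [Ideal.mem_comap, Ideal.Quotient.eq_zero_iff_mem.mpr ha]
      exact p.zero_mem
    have hmax : (p.comap (Ideal.Quotient.mk J)).IsMaximal := by
      rw [← (IsLocalRing.maximalIdeal.isMaximal R).eq_of_le (hp.comap _).ne_top hle]
      exact IsLocalRing.maximalIdeal.isMaximal R
    rw [← Ideal.map_comap_of_surjective _ Ideal.Quotient.mk_surjective p]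
    refine (Ideal.map_eq_top_or_isMaximal_of_surjective _ Ideal.Quotient.mk_surjective
      hmax).resolve_left ?_
    rw [Ideal.map_comap_of_surjective _ Ideal.Quotient.mk_surjective p]
    exact hp.ne_top
  have := Module.length_eq_of_surjective (R := R ⧸ J) (S := R) (M := R ⧸ J)
    Ideal.Quotient.mk_surjective
  rw [this]
  exact Module.length_ne_top

end Lengths

/-! ### Lifting `C(e, n)` to chains over `R`; homology in degrees zero and one. -/

namespace FiberComplex

section Terms

variable {R : Type u} [CommRing R] (I₁ I₂ : Ideal R) {k : ℕ} {x : Fin k → R}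

/-- The degree `j` part of an element of the Koszul complex. -/
def degreePart (j : ℕ) (f : Finset (Fin k) → R) : Finset (Fin k) → R :=
  fun s => if s.card = j then f s else 0

theorem koszul_degreePart (x : Fin k → R) (j : ℕ) (f : Finset (Fin k) → R) :
    koszul R x (degreePart (j + 1) f) = degreePart j (koszul R x f) := by
  funext s
  unfold degreePart
  rw [koszul_apply, koszul_apply]
  split_ifs with hs
  · refine Finset.sum_congr rfl fun a _ => ?_
    split_ifs with ha hc
    · rfl
    · rfl
    · exact absurd (by rw [Finset.card_insert_of_notMem ha, hs]) hc
  · refine Finset.sum_eq_zero fun a _ => ?_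
    split_ifs with ha hc
    · rfl
    · rw [Finset.card_insert_of_notMem ha] at hc
      omega
    · simp

theorem degreePart_vanishBelow (j : ℕ) (f : Finset (Fin k) → R) :
    VanishBelow j (degreePart j f) :=
  fun _ hs => if_neg hs.ne

theorem koszul_apply_mem {x : Fin k → R} {J L : Ideal R} (h : ∀ a, ∀ r ∈ J, x a * r ∈ L)
    {f : Finset (Fin k) → R} {s : Finset (Fin k)}
    (hf : ∀ t : Finset (Fin k), t.card = s.card + 1 → f t ∈ J) : koszul R x f s ∈ L := by
  rw [koszul_apply]
  refine Ideal.sum_mem _ fun a _ => ?_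
  split_ifs with ha
  · exact L.zero_mem
  · exact zsmul_mem (h a _ (hf _ (Finset.card_insert_of_notMem ha))) _

theorem koszul_empty_mem_span_mul {x : Fin k → R} {J : Ideal R} {f : Finset (Fin k) → R}
    (hf : ∀ t : Finset (Fin k), t.card = 1 → f t ∈ J) :
    koszul R x f ∅ ∈ Ideal.span (Set.range x) * J :=
  koszul_apply_mem
    (fun a _ hr => Ideal.mul_mem_mul (Ideal.subset_span (Set.mem_range_self a)) hr)
    (by simpa using hf)

theorem koszul_empty_mem_span (x : Fin k → R) (f : Finset (Fin k) → R) :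
    koszul R x f ∅ ∈ Ideal.span (Set.range x) :=
  Ideal.mul_le_left (J := ⊤) (koszul_empty_mem_span_mul fun _ _ => Submodule.mem_top)

theorem exists_koszul_empty_eq {x : Fin k → R} {J : Ideal R} {r : R}
    (hr : r ∈ Ideal.span (Set.range x) * J) :
    ∃ f : Finset (Fin k) → R, (∀ t, f t ∈ J) ∧ koszul R x f ∅ = r := by
  induction hr using Submodule.mul_induction_on' with
  | mem_mul_mem y hy z hz =>
    -- The element `1` in degree `0` is a cycle, so its multiple by `y ∈ (x)` is a boundary.
    obtain ⟨g, -, hg⟩ := exists_koszul_eq_smul_of_mem_span (x := x) (j := 0)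
      (f := degreePart 0 fun _ => (1 : R)) (degreePart_vanishBelow 0 _) (by
        funext s
        rw [koszul_apply]
        refine Finset.sum_eq_zero fun a _ => ?_
        split_ifs with ha
        · rfl
        · simp [degreePart]) hy
    refine ⟨z • g, fun t => J.mul_mem_right _ hz, ?_⟩
    rw [map_smul, hg]
    simp [degreePart, mul_comm]
  | add a _ b _ ha hb =>
    obtain ⟨f, hf, hf'⟩ := ha
    obtain ⟨g, hg, hg'⟩ := hb
    exact ⟨f + g, fun t => J.add_mem (hf t) (hg t), by rw [map_add, Pi.add_apply, hf', hg']⟩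

variable (x) in
theorem exists_koszul_empty_eq_of_mem_span {r : R} (hr : r ∈ Ideal.span (Set.range x)) :
    ∃ f : Finset (Fin k) → R, koszul R x f ∅ = r := by
  obtain ⟨f, -, hf⟩ := exists_koszul_empty_eq (J := ⊤) (x := x) (r := r) (by simpa using hr)
  exact ⟨f, hf⟩

/-- Reduction of an element of the Koszul complex over `R` to the `j`-th term of `C(x, (e, n))`. -/
def toTerm (k e : ℕ) (n : ℤ) (j : ℕ) :
    (Finset (Fin k) → R) →ₗ[R] Term I₁ I₂ k e n j :=
  LinearMap.pi fun s => Submodule.mkQ _ ∘ₗ LinearMap.proj s.1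

theorem toTerm_surjective (e : ℕ) (n : ℤ) (j : ℕ) :
    Function.Surjective (toTerm I₁ I₂ k e n j) := by
  intro f
  choose g hg using fun s => Submodule.Quotient.mk_surjective _ (f s)
  refine ⟨fun s => if h : s.card = j then g ⟨s, h⟩ else 0, funext fun s => ?_⟩
  rw [← hg s]
  simp [toTerm, s.2]

theorem toTerm_eq_zero_iff {e : ℕ} {n : ℤ} {j : ℕ} {f : Finset (Fin k) → R} :
    toTerm I₁ I₂ k e n j f = 0 ↔
      ∀ s : Finset (Fin k), s.card = j → f s ∈ filt I₁ I₂ e (n - j) := by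
  constructor
  · intro h s hs
    exact (Submodule.Quotient.mk_eq_zero _).mp (congrFun h ⟨s, hs⟩)
  · intro h
    funext s
    exact (Submodule.Quotient.mk_eq_zero _).mpr (h s.1 s.2)

theorem toTerm_eq_iff {e : ℕ} {n : ℤ} {j : ℕ} {f g : Finset (Fin k) → R} :
    toTerm I₁ I₂ k e n j f = toTerm I₁ I₂ k e n j g ↔
      ∀ s : Finset (Fin k), s.card = j → f s - g s ∈ filt I₁ I₂ e (n - j) := by
  rw [← sub_eq_zero, ← map_sub, toTerm_eq_zero_iff]
  rfl

theorem diff_toTerm (hx : ∀ a, x a ∈ I₂) (e : ℕ) (n : ℤ) (j : ℕ) (f : Finset (Fin k) → R) :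
    diff I₁ I₂ hx e n j (toTerm I₁ I₂ k e n (j + 1) f) =
      toTerm I₁ I₂ k e n j (koszul R x f) := by
  funext s
  rw [diff_apply]
  have h1 : toTerm I₁ I₂ k e n j (koszul R x f) s =
      ∑ a : Fin k, if a ∈ s.1 then 0 else
        sgn s.1 a • (Submodule.mkQ (filt I₁ I₂ e (n - j))) (x a • f (insert a s.1)) := by
    change Submodule.mkQ (filt I₁ I₂ e (n - j)) (koszul R x f s.1) = _
    rw [koszul_apply, map_sum]
    refine Finset.sum_congr rfl fun a _ => ?_
    split_ifs
    · exact map_zero _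
    · rw [map_zsmul]
  rw [h1]
  rw [Finset.sum_ite, Finset.sum_const_zero, zero_add]
  symm
  exact Finset.sum_subtype (p := fun a => a ∉ s.1) _ (by simp) _

/-- Exactness of the Koszul complex of `x` over `R` in positive degrees. -/
def KoszulExact (x : Fin k → R) : Prop :=
  ∀ f : Finset (Fin k) → R, VanishBelow 1 f → koszul R x f = 0 → ∃ g, koszul R x g = f

theorem mem_boundaries_iff (hx : ∀ a, x a ∈ I₂) {e : ℕ} {n : ℤ} {j : ℕ}
    {f : Finset (Fin k) → R} :
    toTerm I₁ I₂ k e n j f ∈ boundaries I₁ I₂ hx e n j ↔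
      ∃ g : Finset (Fin k) → R, ∀ s : Finset (Fin k), s.card = j →
        f s - koszul R x g s ∈ filt I₁ I₂ e (n - j) := by
  constructor
  · rintro ⟨g, hg⟩
    obtain ⟨g, rfl⟩ := toTerm_surjective I₁ I₂ e n (j + 1) g
    rw [diff_toTerm] at hg
    exact ⟨g, (toTerm_eq_iff I₁ I₂).mp hg.symm⟩
  · rintro ⟨g, hg⟩
    rw [(toTerm_eq_iff I₁ I₂).mpr hg, ← diff_toTerm I₁ I₂ hx]
    exact ⟨_, rfl⟩

theorem mem_cycles_iff (hx : ∀ a, x a ∈ I₂) {e : ℕ} {n : ℤ} {j : ℕ}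
    {f : Finset (Fin k) → R} :
    toTerm I₁ I₂ k e n (j + 1) f ∈ cycles I₁ I₂ hx e n (j + 1) ↔
      ∀ s : Finset (Fin k), s.card = j → koszul R x f s ∈ filt I₁ I₂ e (n - j) := by
  rw [cycles, LinearMap.mem_ker, diff_toTerm, toTerm_eq_zero_iff]

/-- The homology class of an element of a submodule `P` all of whose elements reduce to cycles. -/
def classMap (hx : ∀ a, x a ∈ I₂) (e : ℕ) (n : ℤ) (j : ℕ)
    (P : Submodule R (Finset (Fin k) → R))
    (hP : ∀ f ∈ P, toTerm I₁ I₂ k e n j f ∈ cycles I₁ I₂ hx e n j) :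
    P →ₗ[R] Homology I₁ I₂ hx e n j :=
  Submodule.mkQ _ ∘ₗ (toTerm I₁ I₂ k e n j).restrict hP

theorem classMap_eq_zero_iff (hx : ∀ a, x a ∈ I₂) {e : ℕ} {n : ℤ} {j : ℕ}
    {P : Submodule R (Finset (Fin k) → R)}
    {hP : ∀ f ∈ P, toTerm I₁ I₂ k e n j f ∈ cycles I₁ I₂ hx e n j} (f : P) :
    classMap I₁ I₂ hx e n j P hP f = 0 ↔
      toTerm I₁ I₂ k e n j f ∈ boundaries I₁ I₂ hx e n j :=
  Submodule.Quotient.mk_eq_zero _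

theorem classMap_surjective (hx : ∀ a, x a ∈ I₂) {e : ℕ} {n : ℤ} {j : ℕ}
    {P : Submodule R (Finset (Fin k) → R)}
    {hP : ∀ f ∈ P, toTerm I₁ I₂ k e n j f ∈ cycles I₁ I₂ hx e n j}
    (h : ∀ f, toTerm I₁ I₂ k e n j f ∈ cycles I₁ I₂ hx e n j → f ∈ P) :
    Function.Surjective (classMap I₁ I₂ hx e n j P hP) := by
  intro c
  obtain ⟨⟨c, hc⟩, rfl⟩ := Submodule.Quotient.mk_surjective _ c
  obtain ⟨f, rfl⟩ := toTerm_surjective I₁ I₂ e n j c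
  exact ⟨⟨f, h f hc⟩, rfl⟩

theorem h_zero (hx : ∀ a, x a ∈ I₂) (e : ℕ) (n : ℤ) :
    (h I₁ I₂ hx e n 0 : ℤ) = colen (Ideal.span (Set.range x) ⊔ filt I₁ I₂ e n) := by
  rw [h, colen, Nat.cast_inj]
  have hP : ∀ f : Finset (Fin k) → R, toTerm I₁ I₂ k e n 0 f ∈ cycles I₁ I₂ hx e n 0 :=
    fun _ => Submodule.mem_top
  refine len_eq_of_ker_eq (P := (⊤ : Submodule R (Finset (Fin k) → R)))
    (classMap I₁ I₂ hx e n 0 ⊤ fun f _ => hP f)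
    (Submodule.mkQ _ ∘ₗ LinearMap.proj ∅ ∘ₗ Submodule.subtype _)
    (classMap_surjective I₁ I₂ hx fun _ _ => Submodule.mem_top) ?_ ?_
  · intro r
    obtain ⟨r, rfl⟩ := Submodule.Quotient.mk_surjective _ r
    exact ⟨⟨fun _ => r, Submodule.mem_top⟩, rfl⟩
  · intro f
    rw [classMap_eq_zero_iff, mem_boundaries_iff]
    have : (Submodule.mkQ (Ideal.span (Set.range x) ⊔ filt I₁ I₂ e n) ∘ₗ LinearMap.proj ∅ ∘ₗ
        Submodule.subtype _) f = 0 ↔ f.1 ∅ ∈ Ideal.span (Set.range x) ⊔ filt I₁ I₂ e n :=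
      Submodule.Quotient.mk_eq_zero _
    rw [this, Submodule.mem_sup]
    simp only [Finset.card_eq_zero, forall_eq, Nat.cast_zero, sub_zero]
    constructor
    · rintro ⟨g, hg⟩
      exact ⟨_, koszul_empty_mem_span x g, _, hg, by ring⟩
    · rintro ⟨y, hy, z, hz, hyz⟩
      obtain ⟨g, rfl⟩ := exists_koszul_empty_eq_of_mem_span x hy
      exact ⟨g, by rwa [← hyz, add_sub_cancel_left]⟩

/-- A chain reduces to a 1-cycle when its Koszul boundary in degree `0`, which always lies in `(x)`,
also lies in the filtration ideal. Exactness of the complex over `R` identifies the kernel of this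
boundary map modulo `(x) * filt`. -/
theorem h_one (hx : ∀ a, x a ∈ I₂) (hex : KoszulExact x) (e : ℕ) (n : ℤ) :
    h I₁ I₂ hx e n 1 = len R (IdealQuot (Ideal.span (Set.range x) ⊓ filt I₁ I₂ e n)
      (Ideal.span (Set.range x) * filt I₁ I₂ e (n - 1))) := by
  let P : Submodule R (Finset (Fin k) → R) :=
    Submodule.comap (LinearMap.proj ∅ ∘ₗ koszul R x) (filt I₁ I₂ e n)
  have hP : ∀ f, toTerm I₁ I₂ k e n 1 f ∈ cycles I₁ I₂ hx e n 1 ↔ f ∈ P := by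
    intro f
    rw [mem_cycles_iff]
    simp [P]
  have hQ : ∀ f ∈ P, (LinearMap.proj ∅ ∘ₗ koszul R x) f ∈
      (Ideal.span (Set.range x) ⊓ filt I₁ I₂ e n : Ideal R) :=
    fun f hf => ⟨koszul_empty_mem_span x f, hf⟩
  refine len_eq_of_ker_eq (P := P)
    (classMap I₁ I₂ hx e n 1 P fun f hf => (hP f).mpr hf)
    (Submodule.mkQ _ ∘ₗ (LinearMap.proj ∅ ∘ₗ koszul R x).restrict hQ)
    (classMap_surjective I₁ I₂ hx fun f hf => (hP f).mp hf) ?_ ?_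
  · intro r
    obtain ⟨⟨r, hr⟩, rfl⟩ := Submodule.Quotient.mk_surjective _ r
    obtain ⟨f, rfl⟩ := exists_koszul_empty_eq_of_mem_span x hr.1
    exact ⟨⟨f, hr.2⟩, rfl⟩
  · intro f
    rw [classMap_eq_zero_iff, mem_boundaries_iff]
    have : (Submodule.mkQ (Submodule.submoduleOf (Ideal.span (Set.range x) * filt I₁ I₂ e (n - 1))
        (Ideal.span (Set.range x) ⊓ filt I₁ I₂ e n)) ∘ₗ
          (LinearMap.proj ∅ ∘ₗ koszul R x).restrict hQ) f = 0 ↔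
        koszul R x f.1 ∅ ∈ Ideal.span (Set.range x) * filt I₁ I₂ e (n - 1) :=
      Submodule.Quotient.mk_eq_zero _
    rw [this]
    simp only [Nat.cast_one]
    constructor
    · rintro ⟨g, hg⟩
      have h1 := koszul_empty_mem_span_mul (x := x) (f := f.1 - koszul R x g) hg
      rwa [map_sub, koszul_koszul, sub_zero] at h1
    · intro hf
      obtain ⟨g, hg, hgf⟩ := exists_koszul_empty_eq hf
      -- `f` and `g` have the same boundary in degree `0`, and `g` reduces to zero; their difference
      -- in degree `1` is a cycle over `R`, hence a boundary.
      obtain ⟨c, hc⟩ := hex (degreePart 1 (f.1 - g)) (degreePart_vanishBelow 1 _) (by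
        rw [koszul_degreePart]
        funext s
        unfold degreePart
        split_ifs with hs
        · rw [Finset.card_eq_zero.mp hs, map_sub, Pi.sub_apply, hgf, sub_self, Pi.zero_apply]
        · rfl)
      refine ⟨c, fun s hs => ?_⟩
      rw [hc, degreePart, if_pos hs, Pi.sub_apply, sub_sub_cancel]
      exact hg s

end Terms

end FiberComplex

/-! ### The Euler characteristic. -/

namespace FiberComplex

section Euler

variable {R : Type u} [CommRing R] {I₁ I₂ : Ideal R} {k : ℕ} {x : Fin k → R}

theorem length_term_ne_top {e : ℕ} {n : ℤ} {j : ℕ}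
    (hfin : Module.length R (R ⧸ filt I₁ I₂ e (n - j)) ≠ ⊤) :
    Module.length R (Term I₁ I₂ k e n j) ≠ ⊤ := by
  rw [Module.length_pi_of_fintype, Finset.sum_const, nsmul_eq_mul]
  lift Module.length R (R ⧸ filt I₁ I₂ e (n - j)) to ℕ using hfin with l
  exact_mod_cast ENat.natCast_ne_top (Finset.univ.card * l)

theorem length_homology_ne_top (hx : ∀ a, x a ∈ I₂) {e : ℕ} {n : ℤ} {j : ℕ}
    (hfin : Module.length R (R ⧸ filt I₁ I₂ e (n - j)) ≠ ⊤) :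
    Module.length R (Homology I₁ I₂ hx e n j) ≠ ⊤ :=
  length_quotient_ne_top (length_submodule_ne_top (length_term_ne_top hfin) _) _

theorem len_term (e : ℕ) (n : ℤ) (j : ℕ) :
    (len R (Term I₁ I₂ k e n j) : ℤ) = k.choose j * colen (filt I₁ I₂ e (n - j)) := by
  rw [len, Module.length_pi_of_fintype, Finset.sum_const, nsmul_eq_mul, ENat.toNat_mul,
    ENat.toNat_natCast, Finset.card_univ, Fintype.card_finset_len, Fintype.card_fin, colen, len]
  push_cast
  rfl

/-- The Euler characteristic of `C(x, (e, n))`. -/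
theorem sum_h (hx : ∀ a, x a ∈ I₂) (e : ℕ) (n : ℤ)
    (hfin : ∀ m, Module.length R (R ⧸ filt I₁ I₂ e m) ≠ ⊤) :
    ∑ j ∈ Finset.range (k + 1), (-1) ^ j * (h I₁ I₂ hx e n j : ℤ) =
      ∑ j ∈ Finset.range (k + 1), (-1) ^ j * (k.choose j * colen (filt I₁ I₂ e (n - j))) := by
  have hT : ∀ j, Module.length R (Term I₁ I₂ k e n j) ≠ ⊤ := fun j => length_term_ne_top (hfin _)
  let b : ℕ → ℤ := fun j => len R (boundaries I₁ I₂ hx e n j)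
  let z : ℕ → ℤ := fun j => len R (cycles I₁ I₂ hx e n j)
  have hh : ∀ j, (h I₁ I₂ hx e n j : ℤ) = z j - b j := by
    intro j
    have h1 := len_quotient_add_len (length_submodule_ne_top (hT j) (cycles I₁ I₂ hx e n j))
      (Submodule.submoduleOf (boundaries I₁ I₂ hx e n j) (cycles I₁ I₂ hx e n j))
    have h2 : len R (Submodule.submoduleOf (boundaries I₁ I₂ hx e n j) (cycles I₁ I₂ hx e n j)) =
        len R (boundaries I₁ I₂ hx e n j) :=
      len_eq_of_equiv (Submodule.submoduleOfEquivOfLe (boundaries_le_cycles I₁ I₂ hx e n j))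
    rw [h2] at h1
    simp only [h, z, b]
    rw [h1]
    push_cast
    ring
  have hz0 : z 0 = len R (Term I₁ I₂ k e n 0) := by
    exact congrArg Nat.cast
      (len_eq_of_equiv (Submodule.topEquiv (R := R) (M := Term I₁ I₂ k e n 0)))
  have hz : ∀ j, (len R (Term I₁ I₂ k e n (j + 1)) : ℤ) = z (j + 1) + b j := by
    intro j
    rw [len_quotient_add_len (hT (j + 1)) (LinearMap.ker (diff I₁ I₂ hx e n j)),
      len_eq_of_equiv (diff I₁ I₂ hx e n j).quotKerEquivRange]
    push_cast
    rfl
  have hbk : b k = 0 := by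
    have : Subsingleton (Term I₁ I₂ k e n (k + 1)) := by
      have : IsEmpty (Idx k (k + 1)) := ⟨fun s => by
        have := s.2 ▸ Finset.card_le_univ s.1
        simp at this⟩
      infer_instance
    have := hz k
    rw [len, Module.length_eq_zero] at this
    simp only [z, b] at this ⊢
    simp only [ENat.toNat_zero, Nat.cast_zero] at this
    omega
  -- Truncating the alternating sum at `m` leaves one uncancelled boundary length; at `m = k` it is
  -- zero.
  have partial_sum : ∀ m, ∑ j ∈ Finset.range (m + 1), (-1) ^ j * (h I₁ I₂ hx e n j : ℤ) =
      ∑ j ∈ Finset.range (m + 1), (-1) ^ j * (len R (Term I₁ I₂ k e n j) : ℤ) -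
        (-1) ^ m * b m := by
    intro m
    induction m with
    | zero => simp [hh, hz0]
    | succ m ih =>
      rw [Finset.sum_range_succ, ih, Finset.sum_range_succ _ (m + 1), hh, hz]
      ring
  rw [partial_sum, hbk, mul_zero, sub_zero]
  simp only [len_term]

end Euler

/-! ### Vanishing of positive homology for large `n`. -/

section Vanishing

variable {R : Type u} [CommRing R] {I₁ I₂ : Ideal R} {k : ℕ} {x : Fin k → R}

/-- The filtration by `I₁ ^ e * I₂ ^ i` on the Koszul complex of `x` over `R`. -/
def koszulFiltration (hx : Ideal.span (Set.range x) ≤ I₂) (e : ℕ) :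
    (Ideal.span (Set.range x)).Filtration (Finset (Fin k) → R) where
  N i := Submodule.pi Set.univ fun _ => I₁ ^ e * I₂ ^ i
  mono i := Submodule.pi_mono fun _ _ => Ideal.mul_mono_right (Ideal.pow_le_pow_right i.le_succ)
  smul_le i := by
    rw [Submodule.smul_le]
    intro r hr f hf s _
    have h1 : r * f s ∈ I₂ * (I₁ ^ e * I₂ ^ i) := Ideal.mul_mem_mul (hx hr) (hf s trivial)
    have h2 : I₂ * (I₁ ^ e * I₂ ^ i) = I₁ ^ e * I₂ ^ (i + 1) := by ring
    rwa [h2] at h1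

theorem mem_koszulFiltration {hx : Ideal.span (Set.range x) ≤ I₂} {e i : ℕ}
    {f : Finset (Fin k) → R} :
    f ∈ (koszulFiltration (I₁ := I₁) hx e).N i ↔ ∀ s, f s ∈ I₁ ^ e * I₂ ^ i := by
  simp [koszulFiltration]

/-- The reduction identity `(x) I₂ ^ i = I₂ ^ (i + 1)` holds for all large `i`; it passes to the
finite product coordinate by coordinate. -/
theorem koszulFiltration_stable (hred : IsReduction I₂ (Ideal.span (Set.range x))) (e : ℕ) :
    (koszulFiltration (I₁ := I₁) hred.1 e).Stable := by
  obtain ⟨hle, c, hc⟩ := hred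
  refine ⟨c, fun i hi => le_antisymm (Ideal.Filtration.smul_le _ _) fun f hf => ?_⟩
  rw [mem_koszulFiltration] at hf
  have hpow : Ideal.span (Set.range x) * I₂ ^ i = I₂ ^ (i + 1) := by
    obtain ⟨m, rfl⟩ := Nat.exists_eq_add_of_le hi
    rw [pow_add, ← mul_assoc, hc, ← pow_add]
    congr 1
    omega
  have hsingle : ∀ s, ∀ r ∈ Ideal.span (Set.range x) * (I₁ ^ e * I₂ ^ i),
      (Pi.single s r : Finset (Fin k) → R) ∈
        Ideal.span (Set.range x) • (koszulFiltration (I₁ := I₁) hle e).N i := by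
    intro s r hr
    induction hr using Submodule.mul_induction_on' with
    | mem_mul_mem y hy z hz =>
      have : (Pi.single s (y * z) : Finset (Fin k) → R) = y • Pi.single s z := by
        rw [← Pi.single_smul, smul_eq_mul]
      rw [this]
      refine Submodule.smul_mem_smul hy (mem_koszulFiltration.mpr fun t => ?_)
      by_cases hts : t = s
      · subst hts
        simpa using hz
      · simp [hts]
    | add a _ b _ ha hb =>
      rw [Pi.single_add]
      exact add_mem ha hb
  rw [← Finset.univ_sum_single f]
  refine Submodule.sum_mem _ fun s _ => hsingle s _ ?_
  rw [← mul_assoc, mul_comm _ (I₁ ^ e), mul_assoc, hpow]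
  exact hf s

theorem wedge_apply_mem {A : Ideal R} (b : Fin k) {f : Finset (Fin k) → R} (hf : ∀ s, f s ∈ A)
    (s : Finset (Fin k)) : wedge b f s ∈ A := by
  unfold wedge
  split_ifs
  · exact zsmul_mem (hf _) _
  · exact A.zero_mem

/-- The homotopy `wedge` only permutes coordinates up to sign or inserts zeros, so the preimage
keeps its coordinates in `A`. -/
theorem exists_koszul_eq_of_mem_smul {A : Ideal R} {f : Finset (Fin k) → R}
    (hf : f ∈ Ideal.span (Set.range x) •
      (LinearMap.ker (koszul R x) ⊓ Submodule.pi Set.univ fun _ => A)) :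
    ∃ g, (∀ s, g s ∈ A) ∧ koszul R x g = f := by
  induction hf using Submodule.smul_induction_on' with
  | smul z hz f hf =>
    have hfA : ∀ s, f s ∈ A := fun s => hf.2 s trivial
    clear * - hz hf hfA
    induction hz using Submodule.span_induction with
    | mem z hz =>
      obtain ⟨b, rfl⟩ := hz
      refine ⟨wedge b f, wedge_apply_mem b hfA, ?_⟩
      rw [← koszul_wedge_add, LinearMap.mem_ker.mp hf.1]
      have : wedge b (0 : Finset (Fin k) → R) = 0 := by
        funext s
        simp [wedge]
      rw [this, add_zero]
    | zero => exact ⟨0, fun _ => A.zero_mem, by simp⟩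
    | add z w _ _ hz hw =>
      obtain ⟨g, hg, hg'⟩ := hz
      obtain ⟨g₁, hg₁, hg₁'⟩ := hw
      exact ⟨g + g₁, fun s => A.add_mem (hg s) (hg₁ s), by rw [map_add, hg', hg₁', add_smul]⟩
    | smul c z _ hz =>
      obtain ⟨g, hg, hg'⟩ := hz
      exact ⟨c • g, fun s => A.mul_mem_left c (hg s), by rw [map_smul, hg', smul_assoc]⟩
  | add f _ f' _ hf hf' =>
    obtain ⟨g, hg, hg'⟩ := hf
    obtain ⟨g₁, hg₁, hg₁'⟩ := hf'
    exact ⟨g + g₁, fun s => A.add_mem (hg s) (hg₁ s), by rw [map_add, hg', hg₁']⟩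

/-- By Artin–Rees, cycles in filtration step `i + 1` lie in `(x)` times cycles in step `i`, and such
elements are boundaries from step `i`. -/
theorem exists_koszul_eq_of_large [IsNoetherianRing R]
    (hred : IsReduction I₂ (Ideal.span (Set.range x))) (e : ℕ) :
    ∃ c : ℕ, ∀ i, c ≤ i → ∀ f : Finset (Fin k) → R, koszul R x f = 0 →
      (∀ s, f s ∈ I₁ ^ e * I₂ ^ (i + 1)) →
        ∃ g, (∀ s, g s ∈ I₁ ^ e * I₂ ^ i) ∧ koszul R x g = f := by
  obtain ⟨c, hc⟩ := (koszulFiltration_stable (I₁ := I₁) hred e).inter_left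
    (F' := Ideal.trivialFiltration _ (LinearMap.ker (koszul R x)))
  refine ⟨c, fun i hi f hf hf' => exists_koszul_eq_of_mem_smul ?_⟩
  have : f ∈ (LinearMap.ker (koszul R x) ⊓
      (koszulFiltration (I₁ := I₁) hred.1 e).N (i + 1) : Submodule R _) :=
    ⟨hf, mem_koszulFiltration.mpr hf'⟩
  exact (hc i hi).ge this

theorem h_eq_zero_of_large [IsNoetherianRing R]
    (hred : IsReduction I₂ (Ideal.span (Set.range x))) (hex : KoszulExact x)
    (hx : ∀ a, x a ∈ I₂) (e : ℕ) :
    ∃ c : ℕ, ∀ n : ℕ, c ≤ n → ∀ j, 1 ≤ j → j ≤ k → h I₁ I₂ hx e n j = 0 := by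
  obtain ⟨c, hc⟩ := exists_koszul_eq_of_large (I₁ := I₁) hred e
  refine ⟨c + k, fun n hn j hj hjk => ?_⟩
  obtain ⟨j, rfl⟩ := Nat.exists_eq_add_of_le' hj
  obtain ⟨i, rfl⟩ := Nat.exists_eq_add_of_le (show j + 1 ≤ n by omega)
  have hsub : cycles I₁ I₂ hx e ((j + 1 + i : ℕ) : ℤ) (j + 1) ≤
      boundaries I₁ I₂ hx e ((j + 1 + i : ℕ) : ℤ) (j + 1) := by
    intro f hf
    obtain ⟨f, rfl⟩ := toTerm_surjective I₁ I₂ e _ (j + 1) f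
    rw [mem_cycles_iff] at hf
    have h1 : filt I₁ I₂ e (((j + 1 + i : ℕ) : ℤ) - j) = I₁ ^ e * I₂ ^ (i + 1) := by
      rw [filt, ipow]
      congr 2
      omega
    have h2 : filt I₁ I₂ e (((j + 1 + i : ℕ) : ℤ) - (j + 1 : ℕ)) = I₁ ^ e * I₂ ^ i := by
      rw [filt, ipow]
      congr 2
      omega
    rw [h1] at hf
    -- The boundary of a lifted cycle is a true cycle deep in the filtration, so it is also the
    -- boundary of some `g` that reduces to zero. Then `f - g` in degree `j + 1` is a cycle over
    -- `R`, to which exactness applies.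
    obtain ⟨g, hg, hgf⟩ := hc i (by omega) (koszul R x (degreePart (j + 1) f))
      (koszul_koszul _ _) (by
        intro s
        rw [koszul_degreePart]
        unfold degreePart
        split_ifs with hs
        · exact hf s hs
        · exact Ideal.zero_mem _)
    obtain ⟨b, hb⟩ := hex (degreePart (j + 1) (f - g))
      (fun s hs => degreePart_vanishBelow (j + 1) _ s (by omega)) (by
        rw [koszul_degreePart, map_sub, hgf, koszul_degreePart]
        funext s
        unfold degreePart
        split_ifs with hs <;> simp [hs])
    rw [mem_boundaries_iff, h2]
    refine ⟨b, fun s hs => ?_⟩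
    rw [hb, degreePart, if_pos hs, Pi.sub_apply, sub_sub_cancel]
    exact hg s
  have : Subsingleton (Homology I₁ I₂ hx e ((j + 1 + i : ℕ) : ℤ) (j + 1)) := by
    rw [Submodule.Quotient.subsingleton_iff, Submodule.submoduleOf_eq_top]
    exact hsub
  rw [h, len, Module.length_eq_zero, ENat.toNat_zero]

end Vanishing

/-- Depth sensitivity, applied to a regular sequence of length `d` whose elements have powers in
`(x)`, leaves homology only in degree `0`. -/
theorem koszulExact_of_isCohenMacaulayLocal {R : Type u} [CommRing R] [IsLocalRing R]
    (hCM : IsCohenMacaulayLocal R) {d : ℕ} (hdim : ringKrullDim R = (d : WithBot ℕ∞))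
    {x : Fin d → R} (hx : IsLocalRing.maximalIdeal R ≤ (Ideal.span (Set.range x)).radical) :
    KoszulExact x := by
  obtain ⟨-, rs, hrs, hreg, hlen⟩ := hCM
  have hlen' : rs.length = d := by
    rw [hdim] at hlen
    exact_mod_cast hlen
  intro f hf hD
  obtain ⟨g, -, hg⟩ := koszul_exact x rs R hreg.toIsWeaklyRegular (fun y hy => hx (hrs y hy)) 1
    (by omega) f hf hD
  exact ⟨g, hg⟩

end FiberComplex

/-! ### Hilbert coefficients from generating functions. -/

section HilbertCoefficients

open PowerSeries in
theorem coeff_one_sub_X_pow (d n : ℕ) :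
    coeff n ((1 - X : ℤ⟦X⟧) ^ d) = (-1) ^ n * (d.choose n : ℤ) := by
  have h1 : (1 - X : ℤ⟦X⟧) ^ d =
      (((1 + Polynomial.X : Polynomial ℤ).comp (Polynomial.C (-1) * Polynomial.X)) ^ d :
        Polynomial ℤ) := by
    simp [sub_eq_add_neg]
  rw [h1, ← Polynomial.pow_comp, Polynomial.coeff_coe, Polynomial.comp_C_mul_X_coeff,
    Polynomial.coeff_one_add_X_pow, mul_comm]

open PowerSeries in
/-- If `b` is the `d`-th difference of `F`, extended by `F 0` to negative integers, then
`(1 - X) ^ d ∑ F n X ^ n = ∑ b n X ^ n + F 0 (1 - X) ^ (d - 1)`. -/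
theorem one_sub_X_pow_mul_mk (F : ℕ → ℤ) (d : ℕ) (b : ℕ → ℤ)
    (hb : ∀ n, b n = ∑ j ∈ Finset.range (d + 1 + 1), (-1) ^ j * ((d + 1).choose j * F (n - j))) :
    (1 - X : ℤ⟦X⟧) ^ (d + 1) * mk F = mk b + C (F 0) * (1 - X : ℤ⟦X⟧) ^ d := by
  ext n
  rw [coeff_mul, Finset.Nat.sum_antidiagonal_eq_sum_range_succ_mk, map_add, coeff_C_mul,
    coeff_mk, coeff_one_sub_X_pow, ← Int.alternating_sum_range_choose_eq_choose, hb]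
  simp only [coeff_one_sub_X_pow, coeff_mk]
  have hext : ∀ G : ℕ → ℤ,
      ∑ j ∈ Finset.range (d + 1 + 1), (-1) ^ j * ((d + 1).choose j * G j) =
        ∑ j ∈ Finset.range (d + 1 + 1 + n), (-1) ^ j * ((d + 1).choose j * G j) := by
    intro G
    refine Finset.sum_subset (Finset.range_mono (by omega)) fun j _ hj => ?_
    rw [Finset.mem_range, not_lt] at hj
    rw [Nat.choose_eq_zero_of_lt (by omega)]
    simp
  have hzero : ∑ j ∈ Finset.range (d + 1 + 1), (-1 : ℤ) ^ j * ((d + 1).choose j * F 0) = 0 := by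
    simp only [← mul_assoc]
    rw [← Finset.sum_mul, Int.alternating_sum_range_choose_eq_choose]
    simp
  -- After subtracting the constant `F 0`, the terms with `j > n` vanish, since truncated
  -- subtraction gives `F (n - j) = F 0`.
  have hsub : ∑ j ∈ Finset.range (d + 1 + 1), (-1 : ℤ) ^ j * ((d + 1).choose j * (F (n - j) - F 0))
      = ∑ j ∈ Finset.range (n + 1), (-1) ^ j * ((d + 1).choose j * (F (n - j) - F 0)) := by
    rw [hext fun j => F (n - j) - F 0]
    symm
    refine Finset.sum_subset (Finset.range_mono (by omega)) fun j _ hj => ?_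
    rw [Finset.mem_range, not_lt] at hj
    rw [Nat.sub_eq_zero_of_le (by omega)]
    simp
  simp only [mul_sub, Finset.sum_sub_distrib] at hsub
  rw [hzero, sub_zero] at hsub
  rw [hsub, Finset.mul_sum, ← Finset.sum_sub_distrib, ← Finset.sum_add_distrib]
  exact Finset.sum_congr rfl fun j _ => by ring

open PowerSeries in
theorem eventually_eq_iff_exists_polynomial (F H : ℕ → ℤ) :
    (∀ᶠ n in Filter.atTop, F n = H n) ↔ ∃ p : Polynomial ℤ, mk F = mk H + (p : ℤ⟦X⟧) := by
  constructor
  · intro h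
    obtain ⟨N, hN⟩ := Filter.eventually_atTop.mp h
    refine ⟨trunc N (mk F - mk H), ?_⟩
    ext n
    rw [map_add, Polynomial.coeff_coe, coeff_trunc]
    split_ifs with hn
    · simp
    · simp [hN n (by omega)]
  · rintro ⟨p, hp⟩
    filter_upwards [Filter.eventually_gt_atTop p.natDegree] with n hn
    have := congrArg (coeff n) hp
    rwa [map_add, Polynomial.coeff_coe, Polynomial.coeff_eq_zero_of_natDegree_lt hn, add_zero,
      coeff_mk, coeff_mk] at this

/-- The polynomial `∑ (-1) ^ i f_i binom (n + d - 1 - i) (d - 1 - i)` with coefficients `f`. -/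
def hilbertPolyEval {d : ℕ} (f : Fin d → ℤ) (n : ℕ) : ℤ :=
  ∑ i : Fin d, (-1) ^ (i : ℕ) * f i * ((n + (d - 1 - (i : ℕ))).choose (d - 1 - (i : ℕ)) : ℤ)

open PowerSeries in
theorem one_sub_X_pow_mul_mk_hilbertPolyEval {d : ℕ} (f : Fin d → ℤ) :
    (1 - X : ℤ⟦X⟧) ^ d * mk (hilbertPolyEval f) =
      ((∑ i : Fin d, Polynomial.C (f i) * (Polynomial.X - 1) ^ (i : ℕ) : Polynomial ℤ) : ℤ⟦X⟧) := by
  have h1 : mk (hilbertPolyEval f) = ∑ i : Fin d, C ((-1) ^ (i : ℕ) * f i) *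
      (mk fun n => ((d - 1 - i + n).choose (d - 1 - i) : ℤ) : ℤ⟦X⟧) := by
    ext n
    simp only [hilbertPolyEval, coeff_mk, map_sum, coeff_C_mul, add_comm]
  have h2 : ∀ i : Fin d, (1 - X : ℤ⟦X⟧) ^ d * (C ((-1) ^ (i : ℕ) * f i) *
      (mk fun n => ((d - 1 - i + n).choose (d - 1 - i) : ℤ) : ℤ⟦X⟧)) =
        C (f i) * (X - 1) ^ (i : ℕ) := by
    intro i
    -- The first part of the exponent cancels the binomial series; the remaining `(1 - X) ^ i`
    -- absorbs the sign `(-1) ^ i`.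
    have h3 : d = (d - 1 - i + 1) + i := by omega
    have h4 := mk_add_choose_mul_one_sub_pow_eq_one ℤ (d - 1 - i)
    have h5 : (X - 1 : ℤ⟦X⟧) ^ (i : ℕ) = C ((-1) ^ (i : ℕ)) * (1 - X) ^ (i : ℕ) := by
      rw [map_pow, ← mul_pow]
      simp
    rw [h5]
    calc _ = (1 - X : ℤ⟦X⟧) ^ ((d - 1 - i + 1) + i) * (C ((-1) ^ (i : ℕ) * f i) *
      (mk fun n => ((d - 1 - i + n).choose (d - 1 - i) : ℤ) : ℤ⟦X⟧)) := by rw [← h3]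
      _ = C (f i) * (C ((-1) ^ (i : ℕ)) * (1 - X) ^ (i : ℕ)) *
        ((mk fun n => ((d - 1 - i + n).choose (d - 1 - i) : ℤ) : ℤ⟦X⟧) *
          (1 - X) ^ (d - 1 - i + 1)) := by
        rw [map_mul, pow_add]
        ring
      _ = _ := by rw [h4, mul_one]
  rw [h1, Finset.mul_sum, Finset.sum_congr rfl fun i _ => h2 i]
  have h6 : ∀ p : Polynomial ℤ, (p : ℤ⟦X⟧) = Polynomial.coeToPowerSeries.ringHom p := fun _ => rfl
  rw [h6, map_sum]
  refine Finset.sum_congr rfl fun i _ => ?_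
  rw [← h6, Polynomial.coe_mul, Polynomial.coe_C, Polynomial.coe_pow, Polynomial.coe_sub,
    Polynomial.coe_X, Polynomial.coe_one]

open PowerSeries in
/-- A sequence `F` with `(1 - X) ^ d ∑ F n X ^ n = G` is eventually the polynomial with
coefficients `f` if and only if `f` lists the Taylor coefficients of `G` at `1`. -/
theorem eventually_eq_hilbertPolyEval_iff {d : ℕ} {F : ℕ → ℤ} {G : Polynomial ℤ}
    (hG : (1 - X : ℤ⟦X⟧) ^ d * mk F = (G : ℤ⟦X⟧)) (f : Fin d → ℤ) :
    (∀ᶠ n in Filter.atTop, F n = hilbertPolyEval f n) ↔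
      ∀ i : Fin d, f i = (Polynomial.taylor 1 G).coeff i := by
  have hne : (1 - X : ℤ⟦X⟧) ^ d ≠ 0 := by
    refine pow_ne_zero _ fun h => ?_
    have := congrArg constantCoeff h
    simp at this
  have htay : Polynomial.taylor 1 (∑ i : Fin d, Polynomial.C (f i) *
      (Polynomial.X - 1) ^ (i : ℕ) : Polynomial ℤ) =
        ∑ i : Fin d, Polynomial.C (f i) * Polynomial.X ^ (i : ℕ) := by
    rw [map_sum]
    refine Finset.sum_congr rfl fun i _ => ?_
    rw [Polynomial.taylor_mul, Polynomial.taylor_pow, map_sub, Polynomial.taylor_C,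
      Polynomial.taylor_X, Polynomial.taylor_one, Polynomial.C_1, add_sub_cancel_right]
  have hcoeff : ∀ i : Fin d, (∑ j : Fin d, Polynomial.C (f j) *
      Polynomial.X ^ (j : ℕ) : Polynomial ℤ).coeff i = f i := by
    intro i
    rw [Polynomial.finsetSum_coeff, Finset.sum_eq_single i]
    · simp
    · intro j _ hj
      rw [Polynomial.coeff_C_mul, Polynomial.coeff_X_pow, if_neg, mul_zero]
      exact fun h => hj (Fin.ext h.symm)
    · simp
  -- Eventual equality means that the series differ by a polynomial; after multiplying by `(1 - X) ^
  -- d` this is a congruence modulo `(X - 1) ^ d`.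
  have h1 : (∀ᶠ n in Filter.atTop, F n = hilbertPolyEval f n) ↔ ∃ p : Polynomial ℤ,
      G = (∑ i : Fin d, Polynomial.C (f i) * (Polynomial.X - 1) ^ (i : ℕ)) +
        (1 - Polynomial.X) ^ d * p := by
    rw [eventually_eq_iff_exists_polynomial]
    refine exists_congr fun p => ?_
    rw [← mul_right_inj' hne, mul_add, hG, one_sub_X_pow_mul_mk_hilbertPolyEval,
      ← Polynomial.coe_inj (R := ℤ)]
    simp
  rw [h1]
  constructor
  · rintro ⟨p, hp⟩ i
    rw [hp, map_add, htay, Polynomial.coeff_add, hcoeff, Polynomial.taylor_mul,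
      Polynomial.taylor_pow]
    have h2 : Polynomial.taylor 1 (1 - Polynomial.X : Polynomial ℤ) =
        Polynomial.X * (-1) := by
      rw [map_sub]
      simp
    rw [h2, mul_pow, mul_assoc, Polynomial.coeff_X_pow_mul', if_neg (by omega), add_zero]
  · intro hf
    have h3 : (Polynomial.X : Polynomial ℤ) ^ d ∣ Polynomial.taylor 1 G -
        ∑ i : Fin d, Polynomial.C (f i) * Polynomial.X ^ (i : ℕ) := by
      rw [Polynomial.X_pow_dvd_iff]
      intro i hi
      have := hcoeff ⟨i, hi⟩
      simp only at this
      rw [Polynomial.coeff_sub, this, hf, sub_self]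
    obtain ⟨q, hq⟩ := h3
    -- Shift `q` back from `1` to `0`; the sign turns `(1 - X) ^ d` into `(X - 1) ^ d`, which the
    -- shift by `1` sends to `X ^ d`.
    refine ⟨(-1) ^ d * Polynomial.taylor (-1) q, ?_⟩
    apply Polynomial.taylor_injective 1
    rw [map_add, htay, ← sub_eq_iff_eq_add', hq, ← mul_assoc, ← mul_pow, Polynomial.taylor_mul,
      Polynomial.taylor_pow, Polynomial.taylor_taylor]
    have h4 : Polynomial.taylor 1 ((1 - Polynomial.X) * (-1) : Polynomial ℤ) = Polynomial.X := by
      rw [Polynomial.taylor_mul, map_sub, map_neg]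
      simp
    rw [h4]
    simp

/-- The Hilbert coefficients of `F` in terms of its `d`-th difference. -/
theorem eventually_eq_hilbertPolyEval_iff_finsum {F : ℕ → ℤ} {d : ℕ} (hd : 1 ≤ d) {b : ℕ → ℤ}
    (hb : ∀ n, b n = ∑ j ∈ Finset.range (d + 1), (-1) ^ j * (d.choose j * F (n - j)))
    (hfin : {n | b n ≠ 0}.Finite) (f : Fin d → ℤ) :
    (∀ᶠ n in Filter.atTop, F n = hilbertPolyEval f n) ↔
      ∀ i : Fin d, f i = (∑ᶠ (n : ℕ) (_ : (i : ℕ) ≤ n), (n.choose i : ℤ) * b n) -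
        (-1) ^ d * (if (i : ℕ) + 1 = d then F 0 else 0) := by
  obtain ⟨d, rfl⟩ := Nat.exists_eq_add_of_le' hd
  let B : Polynomial ℤ := ∑ n ∈ hfin.toFinset, Polynomial.monomial n (b n)
  have hB : (B : PowerSeries ℤ) = PowerSeries.mk b := by
    ext n
    rw [Polynomial.coeff_coe, PowerSeries.coeff_mk, Polynomial.finsetSum_coeff]
    simp only [Polynomial.coeff_monomial, Finset.sum_ite_eq', Set.Finite.mem_toFinset,
      Set.mem_ofPred_eq]
    split_ifs with h
    · rfl
    · exact (not_not.mp h).symm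
  have hG : (1 - PowerSeries.X : PowerSeries ℤ) ^ (d + 1) * PowerSeries.mk F =
      ((B + Polynomial.C (F 0) * (1 - Polynomial.X) ^ d : Polynomial ℤ) : PowerSeries ℤ) := by
    rw [one_sub_X_pow_mul_mk F d b hb, Polynomial.coe_add, Polynomial.coe_mul, Polynomial.coe_C,
      Polynomial.coe_pow, Polynomial.coe_sub, Polynomial.coe_X, Polynomial.coe_one, hB]
  rw [eventually_eq_hilbertPolyEval_iff hG]
  refine forall_congr' fun i => ?_
  have h1 : (Polynomial.taylor 1 B).coeff i =
      ∑ᶠ (n : ℕ) (_ : (i : ℕ) ≤ n), (n.choose i : ℤ) * b n := by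
    rw [Polynomial.taylor_coeff, map_sum, Polynomial.eval_finsetSum]
    rw [finsum_eq_sum_of_support_subset (s := hfin.toFinset)]
    · refine Finset.sum_congr rfl fun n _ => ?_
      rw [Polynomial.hasseDeriv_monomial, Polynomial.eval_monomial, one_pow, mul_one]
      by_cases hn : (i : ℕ) ≤ n
      · simp [hn]
      · simp [hn, Nat.choose_eq_zero_of_lt (not_le.mp hn)]
    · intro n hn
      simp only [Set.Finite.coe_toFinset, Set.mem_ofPred_eq]
      intro h0
      simp [h0] at hn
  -- The shift turns `(1 - X) ^ d` into `(-X) ^ d`, so only the last coefficient is affected. Here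
  -- `d + 1` is the original `d`.
  have h2 : (Polynomial.taylor 1 (Polynomial.C (F 0) * (1 - Polynomial.X) ^ d)).coeff i =
      -((-1) ^ (d + 1) * (if (i : ℕ) + 1 = d + 1 then F 0 else 0)) := by
    have h3 : Polynomial.taylor 1 (1 - Polynomial.X : Polynomial ℤ) =
        Polynomial.C (-1) * Polynomial.X := by
      rw [map_sub]
      simp
    rw [Polynomial.taylor_mul, Polynomial.taylor_pow, h3, Polynomial.taylor_C, mul_pow,
      ← Polynomial.C_pow, Polynomial.coeff_C_mul, Polynomial.coeff_C_mul, Polynomial.coeff_X_pow]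
    simp only [Nat.add_right_cancel_iff]
    split_ifs <;> ring
  rw [map_add, Polynomial.coeff_add, h1, h2, ← sub_eq_add_neg]

end HilbertCoefficients

/-! ### The brackets as differences of the fiber cone's Hilbert function. -/

section FiberConeFormulas

open FiberComplex

variable {R : Type u} [CommRing R]

theorem filt_zero (I₁ I₂ : Ideal R) (n : ℤ) : filt I₁ I₂ 0 n = ipow I₂ n := by
  rw [filt, pow_zero, one_mul]

theorem filt_one (I₁ I₂ : Ideal R) (n : ℤ) : filt I₁ I₂ 1 n = I₁ * ipow I₂ n := by
  rw [filt, pow_one]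

theorem ipow_natCast (I : Ideal R) (n : ℕ) : ipow I n = I ^ n := rfl

theorem ipow_natCast_sub (I : Ideal R) (n j : ℕ) : ipow I ((n : ℤ) - j) = I ^ (n - j) := by
  rw [ipow]
  congr 1
  omega

theorem colen_top : colen (⊤ : Ideal R) = 0 := by
  rw [colen, len, Module.length_eq_zero, ENat.toNat_zero, Nat.cast_zero]

theorem IsReduction.le_radical {I J : Ideal R} (h : IsReduction I J) : I ≤ J.radical := by
  obtain ⟨-, n, hn⟩ := h
  intro a ha
  refine ⟨n + 1, ?_⟩
  have := Ideal.pow_mem_pow ha (n + 1)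
  rw [← hn] at this
  exact Ideal.mul_le_left this

variable {I₁ I₂ : Ideal R} {d : ℕ} {x : Fin d → R}

theorem span_mul_filt_le (hx : ∀ a, x a ∈ I₂) (e : ℕ) (n : ℤ) :
    Ideal.span (Set.range x) * filt I₁ I₂ e (n - 1) ≤
      Ideal.span (Set.range x) ⊓ filt I₁ I₂ e n := by
  refine le_inf Ideal.mul_le_left ?_
  have hle : Ideal.span (Set.range x) ≤ I₂ :=
    Ideal.span_le.mpr (Set.range_subset_iff.mpr hx)
  exact Ideal.mul_le.mpr fun y hy r hr => mul_mem_filt (hle hy) (by omega) hr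

theorem sum_Icc_eq_add_sum_Icc (f : ℕ → ℤ) {a b : ℕ} (hab : a ≤ b) :
    ∑ j ∈ Finset.Icc a b, f j = f a + ∑ j ∈ Finset.Icc (a + 1) b, f j := by
  have h : Finset.Icc (a + 1) b = Finset.Ioc a b := by
    ext j
    simp only [Finset.mem_Icc, Finset.mem_Ioc]
    omega
  rw [h, Finset.add_sum_Ioc_eq_sum_Icc hab]

/-- The ideals `I₁ ^ e * I₂ ^ n` and `(x) * I₁ ^ e * I₂ ^ n` have finite colength. -/
structure FiniteColengths (I₁ I₂ : Ideal R) (x : Fin d → R) : Prop where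
  length_filt : ∀ e n, Module.length R (R ⧸ filt I₁ I₂ e n) ≠ ⊤
  length_span_mul : ∀ e n, Module.length R (R ⧸ Ideal.span (Set.range x) * filt I₁ I₂ e n) ≠ ⊤

theorem length_quotient_ne_top_of_le {J L : Ideal R} (h : Module.length R (R ⧸ J) ≠ ⊤) (hJL : J ≤ L) :
    Module.length R (R ⧸ L) ≠ ⊤ :=
  ne_top_of_le_ne_top h
    (Module.length_le_of_surjective (Submodule.factor hJL) (Submodule.factor_surjective hJL))

theorem FiniteColengths.length_span_inf (hF : FiniteColengths I₁ I₂ x) (hx : ∀ a, x a ∈ I₂) (e : ℕ)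
    (n : ℤ) : Module.length R (R ⧸ Ideal.span (Set.range x) ⊓ filt I₁ I₂ e n) ≠ ⊤ :=
  length_quotient_ne_top_of_le (hF.length_span_mul e (n - 1)) (span_mul_filt_le hx e n)

theorem FiniteColengths.fiberHilb_eq (hF : FiniteColengths I₁ I₂ x) (n : ℕ) :
    (fiberHilb I₁ I₂ n : ℤ) = colen (filt I₁ I₂ 1 n) - colen (filt I₁ I₂ 0 n) := by
  have h1 := hF.length_filt 1 n
  rw [filt_one, ipow_natCast] at h1
  rw [fiberHilb, len_idealQuot Ideal.mul_le_right h1, filt_one, filt_zero, ipow_natCast]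

theorem FiniteColengths.fiberHilb_zero (hF : FiniteColengths I₁ I₂ x) :
    (fiberHilb I₁ I₂ 0 : ℤ) = len R (R ⧸ I₁) := by
  rw [hF.fiberHilb_eq, filt_one, filt_zero, ipow_natCast, pow_zero, mul_one, Ideal.one_eq_top,
    colen_top, sub_zero, colen]

theorem FiniteColengths.len_idealQuot_sup (hF : FiniteColengths I₁ I₂ x) (hx : ∀ a, x a ∈ I₂)
    (n : ℕ) :
    (len R (IdealQuot (I₂ ^ n) (I₁ * I₂ ^ n + Ideal.span (Set.range x) ⊓ I₂ ^ n)) : ℤ) =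
      (colen (filt I₁ I₂ 1 n) +
        colen (Ideal.span (Set.range x) ⊓ filt I₁ I₂ 0 n) -
          colen (Ideal.span (Set.range x) ⊓ filt I₁ I₂ 1 n)) -
        colen (filt I₁ I₂ 0 n) := by
  have hle : I₁ * I₂ ^ n ≤ I₂ ^ n := Ideal.mul_le_right
  have h1 := hF.length_filt 1 n
  have h2 := hF.length_span_inf hx 1 n
  rw [filt_one, ipow_natCast] at h1 h2
  rw [filt_one, filt_zero, ipow_natCast, Submodule.add_eq_sup,
    len_idealQuot (sup_le hle inf_le_right) (length_quotient_ne_top_of_le h1 le_sup_left)]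
  -- As `I₁ I₂ ^ n ⊆ I₂ ^ n`, inclusion–exclusion for the sum of ideals needs only intersections
  -- with `(x)`.
  have h3 : I₁ * I₂ ^ n ⊓ (Ideal.span (Set.range x) ⊓ I₂ ^ n) =
      Ideal.span (Set.range x) ⊓ I₁ * I₂ ^ n := by
    rw [inf_left_comm, inf_eq_left.mpr hle]
  have h4 := colen_sup_add_colen_inf (A := I₁ * I₂ ^ n)
    (B := Ideal.span (Set.range x) ⊓ I₂ ^ n) (by rwa [h3])
  rw [h3] at h4
  linarith

/-- The first summand is the `d`-th difference of the Hilbert function of the fiber cone. -/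
theorem FiniteColengths.bracketOne_eq (hF : FiniteColengths I₁ I₂ x) (hx : ∀ a, x a ∈ I₂)
    (n : ℕ) : bracketOne I₁ I₂ hx n = ∑ j ∈ Finset.range (d + 1),
      (-1) ^ j * (d.choose j * (fiberHilb I₁ I₂ (n - j) : ℤ)) := by
  have h0 := sum_h hx 0 n (hF.length_filt 0)
  have h1 := sum_h hx 1 n (hF.length_filt 1)
  have hsum : ∑ j ∈ Finset.range (d + 1),
      (-1) ^ j * (d.choose j * (fiberHilb I₁ I₂ (n - j) : ℤ)) =
      ∑ j ∈ Finset.range (d + 1), (-1) ^ j * (h I₁ I₂ hx 1 n j : ℤ) -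
        ∑ j ∈ Finset.range (d + 1), (-1) ^ j * (h I₁ I₂ hx 0 n j : ℤ) := by
    rw [h0, h1, ← Finset.sum_sub_distrib]
    refine Finset.sum_congr rfl fun j _ => ?_
    rw [hF.fiberHilb_eq]
    simp only [filt_one, filt_zero, ipow_natCast_sub, ipow_natCast]
    ring
  simp only [Nat.range_succ_eq_Icc_zero] at hsum ⊢
  -- The degree zero terms are split off; inclusion–exclusion for `(x)` and the filtration ideals
  -- matches them with the length in the bracket.
  rw [hsum, sum_Icc_eq_add_sum_Icc _ d.zero_le, sum_Icc_eq_add_sum_Icc _ d.zero_le, pow_zero,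
    one_mul, one_mul, h_zero, h_zero, bracketOne, hF.len_idealQuot_sup hx]
  have h2 := colen_sup_add_colen_inf (hF.length_span_inf hx 0 n)
  have h3 := colen_sup_add_colen_inf (hF.length_span_inf hx 1 n)
  simp only [mul_sub, Finset.sum_sub_distrib]
  linarith

/-- Substituting `h_one` for the `j = 1` term cancels the colengths of the intersections with `(x)`.
-/
theorem FiniteColengths.bracketTwo_eq_bracketOne (hF : FiniteColengths I₁ I₂ x)
    (hx : ∀ a, x a ∈ I₂) (hex : KoszulExact x) (hd : 1 ≤ d) (n : ℕ) :
    bracketTwo I₁ I₂ hx n = bracketOne I₁ I₂ hx n := by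
  have h1 : ∀ e, (h I₁ I₂ hx e n 1 : ℤ) =
      colen (Ideal.span (Set.range x) * filt I₁ I₂ e ((n : ℤ) - 1)) -
        colen (Ideal.span (Set.range x) ⊓ filt I₁ I₂ e n) := fun e => by
    rw [h_one I₁ I₂ hx hex, len_idealQuot (span_mul_filt_le hx e n) (hF.length_span_mul e _)]
  have h2 : (len R (IdealQuot (Ideal.span (Set.range x) * ipow I₂ ((n : ℤ) - 1))
      (Ideal.span (Set.range x) * (I₁ * ipow I₂ ((n : ℤ) - 1)))) : ℤ) =
      colen (Ideal.span (Set.range x) * filt I₁ I₂ 1 ((n : ℤ) - 1)) -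
        colen (Ideal.span (Set.range x) * filt I₁ I₂ 0 ((n : ℤ) - 1)) := by
    have h3 := hF.length_span_mul 1 ((n : ℤ) - 1)
    rw [filt_one] at h3
    rw [filt_one, filt_zero, len_idealQuot (Ideal.mul_mono_right Ideal.mul_le_right) h3]
  have h4 := hF.fiberHilb_eq n
  rw [fiberHilb] at h4
  rw [bracketTwo, bracketOne, h2, h4, hF.len_idealQuot_sup hx,
    sum_Icc_eq_add_sum_Icc _ hd, h1, h1]
  ring

theorem bracketOne_finite [IsNoetherianRing R] (hx : ∀ a, x a ∈ I₂)
    (hred : IsReduction I₂ (Ideal.span (Set.range x))) (hex : KoszulExact x) :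
    {n : ℕ | bracketOne I₁ I₂ hx n ≠ 0}.Finite := by
  obtain ⟨c₀, h0⟩ := h_eq_zero_of_large (I₁ := I₁) hred hex hx 0
  obtain ⟨c₁, h1⟩ := h_eq_zero_of_large (I₁ := I₁) hred hex hx 1
  obtain ⟨c, hc⟩ := hred.2
  refine (Set.finite_lt_nat (c₀ + c₁ + (c + 1))).subset fun n hn => ?_
  by_contra hlt
  simp only [Set.mem_ofPred_eq, not_lt] at hlt
  refine hn ?_
  -- Beyond the reduction number `I₂ ^ n` lies in `(x)`, so the length in the bracket is zero as
  -- well.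
  have hle : I₂ ^ n ≤ Ideal.span (Set.range x) :=
    (Ideal.pow_le_pow_right (show c + 1 ≤ n by omega)).trans (hc ▸ Ideal.mul_le_left)
  have hsub : Subsingleton (IdealQuot (I₂ ^ n)
      (I₁ * I₂ ^ n + Ideal.span (Set.range x) ⊓ I₂ ^ n)) := by
    rw [Submodule.Quotient.subsingleton_iff, Submodule.submoduleOf_eq_top,
      inf_eq_right.mpr hle, Submodule.add_eq_sup]
    exact le_sup_right
  rw [bracketOne, len, Module.length_eq_zero, Finset.sum_eq_zero]
  · simp
  · intro j hj
    rw [Finset.mem_Icc] at hj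
    rw [h0 n (by omega) j hj.1 hj.2, h1 n (by omega) j hj.1 hj.2]
    simp

theorem FiniteColengths.of_isMaxPrimary [IsLocalRing R] [IsNoetherianRing R]
    (hI₁ : IsMaxPrimary I₁) (hI₂ : IsMaxPrimary I₂)
    (hx : IsLocalRing.maximalIdeal R ≤ (Ideal.span (Set.range x)).radical) :
    FiniteColengths I₁ I₂ x := by
  have hpow : ∀ {I : Ideal R} (m : ℕ), I.radical = IsLocalRing.maximalIdeal R →
      IsLocalRing.maximalIdeal R ≤ (I ^ m).radical := by
    intro I m hI
    rcases Nat.eq_zero_or_pos m with rfl | hm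
    · rw [pow_zero, Ideal.one_eq_top, Ideal.radical_top]
      exact le_top
    · rw [Ideal.radical_pow _ hm.ne', hI]
  have hfilt : ∀ e n, IsLocalRing.maximalIdeal R ≤ (filt I₁ I₂ e n).radical := by
    intro e n
    rw [filt, Ideal.radical_mul]
    exact le_inf (hpow e hI₁.2) (hpow _ hI₂.2)
  refine ⟨fun e n => length_quotient_ne_top_of_le_radical (hfilt e n), fun e n =>
    length_quotient_ne_top_of_le_radical ?_⟩
  rw [Ideal.radical_mul]
  exact le_inf hx (hfilt e n)

end FiberConeFormulas

theorem mainTheorem10 {R : Type u} [CommRing R] [IsLocalRing R]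
    (hCM : IsCohenMacaulayLocal R) [Infinite (IsLocalRing.ResidueField R)]
    (d : ℕ) (hd : 1 ≤ d) (hdim : ringKrullDim R = (d : WithBot ℕ∞))
    (I₁ I₂ : Ideal R) (hI₁ : IsMaxPrimary I₁) (hI₂ : IsMaxPrimary I₂)
    (x : Fin d → R) (hx : ∀ a, x a ∈ I₂)
    (hred : IsMinimalReduction I₂ (Ideal.span (Set.range x)))
    (hsup : IsSuperficialSeq I₁ I₂ x) :
    -- all lengths that occur are finite
    (∀ (e : ℕ) (n : ℤ) (j : ℕ),
      Module.length R (FiberComplex.Homology I₁ I₂ hx e n j) ≠ ⊤) ∧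
    (∀ n : ℕ, Module.length R (IdealQuot (I₂ ^ n) (I₁ * I₂ ^ n)) ≠ ⊤) ∧
    (∀ n : ℤ, Module.length R (IdealQuot (Ideal.span (Set.range x) * ipow I₂ n)
      (Ideal.span (Set.range x) * (I₁ * ipow I₂ n))) ≠ ⊤) ∧
    Module.length R (R ⧸ I₁) ≠ ⊤ ∧
    -- the Hilbert coefficients exist and are unique
    (∃! f : Fin d → ℤ, IsFiberCoeffs I₁ I₂ f) ∧
    -- the sums below are finite
    {n : ℕ | bracketOne I₁ I₂ hx n ≠ 0}.Finite ∧
    {n : ℕ | bracketTwo I₁ I₂ hx n ≠ 0}.Finite ∧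
    -- the two formulas
    ∀ f : Fin d → ℤ, IsFiberCoeffs I₁ I₂ f → ∀ i : Fin d,
      f i = (∑ᶠ (n : ℕ) (_ : (i : ℕ) ≤ n), (n.choose i : ℤ) * bracketOne I₁ I₂ hx n) -
          (-1) ^ d * (len R (R ⧸ Kideal I₁ d i) : ℤ) ∧
      f i = (∑ᶠ (n : ℕ) (_ : (i : ℕ) ≤ n), (n.choose i : ℤ) * bracketTwo I₁ I₂ hx n) -
          (-1) ^ d * (len R (R ⧸ Kideal I₁ d i) : ℤ) := by
  have : IsNoetherianRing R := hCM.1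
  -- A reduction has the same radical as `I₂`; this gives both the finite colengths and the Koszul
  -- exactness.
  have hrad : IsLocalRing.maximalIdeal R ≤ (Ideal.span (Set.range x)).radical := by
    rw [← hI₂.2]
    exact Ideal.radical_le_radical_iff.mpr hred.1.le_radical
  have hF : FiniteColengths I₁ I₂ x := FiniteColengths.of_isMaxPrimary hI₁ hI₂ hrad
  have hex := FiberComplex.koszulExact_of_isCohenMacaulayLocal hCM hdim hrad
  have hfin := bracketOne_finite (I₁ := I₁) hx hred.1 hex
  have htwo : bracketTwo I₁ I₂ hx = bracketOne I₁ I₂ hx :=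
    funext (hF.bracketTwo_eq_bracketOne hx hex hd)
  -- The colength of `K_i` is the boundary correction `F 0` at `i = d - 1`, and zero otherwise.
  have hK : ∀ i : Fin d, (len R (R ⧸ Kideal I₁ d i) : ℤ) =
      if (i : ℕ) + 1 = d then (fiberHilb I₁ I₂ 0 : ℤ) else 0 := by
    intro i
    by_cases hi : (i : ℕ) + 1 = d
    · have h1 : Kideal I₁ d i = I₁ := if_pos hi
      rw [h1, if_pos hi, hF.fiberHilb_zero]
    · have h1 : Kideal I₁ d i = ⊤ := if_neg hi
      rw [h1, if_neg hi]
      exact colen_top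
  have hiff := eventually_eq_hilbertPolyEval_iff_finsum
    (F := fun n => (fiberHilb I₁ I₂ n : ℤ)) hd (hF.bracketOne_eq hx) hfin
  have hcoeffs : ∀ f : Fin d → ℤ, IsFiberCoeffs I₁ I₂ f ↔ ∀ i : Fin d,
      f i = (∑ᶠ (n : ℕ) (_ : (i : ℕ) ≤ n), (n.choose i : ℤ) * bracketOne I₁ I₂ hx n) -
        (-1) ^ d * (len R (R ⧸ Kideal I₁ d i) : ℤ) := by
    intro f
    simp only [hK]
    exact hiff f
  refine ⟨fun e n j => FiberComplex.length_homology_ne_top hx (hF.length_filt e _), fun n => ?_,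
    fun n => ?_, ?_, ?_, hfin, htwo ▸ hfin, fun f hf i => ?_⟩
  · have h1 := hF.length_filt 1 n
    rw [filt_one, ipow_natCast] at h1
    exact length_idealQuot_ne_top h1 _
  · have h1 := hF.length_span_mul 1 n
    rw [filt_one] at h1
    exact length_idealQuot_ne_top h1 _
  · exact length_quotient_ne_top_of_le_radical hI₁.2.ge
  · exact ⟨_, (hcoeffs _).mpr fun _ => rfl, fun f hf => funext fun i => (hcoeffs f).mp hf i⟩
  · rw [htwo]
    exact ⟨(hcoeffs f).mp hf i, (hcoeffs f).mp hf i⟩
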